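/- Let $(E,\mathcal F,\mu)$ be a separable complete probability space and let $(\mathcal E,\mathcal D(\mathcal E))$ be a conservative symmetric Dirichlet form on $L^2(\mu)$. Assume that it is local with a square field, in the following sense. There is a linear space $\mathcal A$ of bounded measurable functions on $E$, stable under products and under composition with Lipschitz functions on $\mathbb R$, which is contained in $\mathcal D(\mathcal E)$ and dense there for the norm $(\|f\|_{L^2(\mu)}^2+\mathcal E(f,f))^{1/2}$. There is also a symmetric bilinear map $\Gamma$ from $\mathcal A\times\mathcal A$ to the bounded measurable functions on $E$ such that, $\mu$-almost everywhere where functions are compared, 1. $\Gamma(f,f)\ge 0$ and $\mathcal E(f,g)=\mu(\Gamma(f,g))$ for $f,g\in\mathcal A$; 2. $\Gamma(\phi\circ f,g)=\phi'(f)\,\Gamma(f,g)$ for $f,g\in\mathcal A$ and $\phi\in C_b^\infty(\mathbb R)$; 3. $\Gamma(fg,h)=g\,\Gamma(f,h)+f\,\Gamma(g,h)$ for $f,g,h\in\mathcal A$. Here $\mu(g)=\int g\,d\mu$. Let $\varrho:E\to[0,\infty)$ be such that $\varrho_n=\min(n,\max(\varrho,-n))\in\mathcal A$ for every integer $n\ge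 0$, and $\Gamma(\varrho,\varrho)\le 1$ $\mu$-a.e., where $\Gamma(\varrho,\varrho):=\Gamma(\varrho_n,\varrho_n)$ on $\{n-1\le\varrho<n\}$ for $n\ge1$. Let $\beta:(0,\infty)\to(0,\infty)$ be continuous and decreasing (not necessarily strictly). For $s>0$ put $\beta^{-1}(s)=\inf\{t>0:\beta(t)\le s\}$, with $\inf\emptyset=\infty$, and assume that $$\eta(s):=\log(2s)\,\bigl(1\wedge\beta^{-1}(s/2)\bigr),\qquad s\ge 1,$$ is bounded. Put $$\alpha(s):=\sup_{t\ge \mu(\varrho\ge s-2)^{-1}}\eta(t),\qquad s\ge 0,$$ where $0^{-1}=\infty$ and $\sup\emptyset=0$. Assume that the Poincaré inequality $$\mu(f^2)\le C_0\,\mathcal E(f,f)+\mu(f)^2,\qquad f\in\mathcal A,$$ holds for some $C_0>0$, and that the super Poincaré inequality $$\mu(f^2)\le r\,\mathcal E(f,f)+\beta(r)\,\mu(|f|)^2,\qquad r>0,\ f\in\mathcal A,$$ holds. Then there is a constant $C>0$ such that $$\mu(f^2\log f^2)\le C\,\mu\bigl(\Gamma(f,f)\,\alpha\circ\varrho\bigr)\qquad\text{for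 all } f\in\mathcal A \text{ with } \mu(f^2)=1.$$ -/

import Mathlib

open MeasureTheory Filter Topology
open scoped ENNReal NNReal ContDiff

/-- A symmetric Dirichlet form on `L²(μ)`: a densely defined, nonnegative, symmetric, closed
bilinear form on which the unit contraction operates. -/
structure DirichletForm {E : Type*} [MeasurableSpace E] (μ : Measure E) where
  /-- the domain `𝒟(ℰ)` -/
  domain : Submodule ℝ (Lp ℝ 2 μ)
  /-- the form `ℰ` -/
  form : LinearMap.BilinForm ℝ domain
  dense_domain : Dense (domain : Set (Lp ℝ 2 μ))
  symm : ∀ u v : domain, form u v = form v u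
  nonneg : ∀ u : domain, 0 ≤ form u u
  /-- The domain is complete for `ℰ₁(u,u) = ‖u‖² + ℰ(u,u)`. -/
  closed : ∀ u : ℕ → domain,
    (∀ ε : ℝ, 0 < ε → ∃ N : ℕ, ∀ m n : ℕ, N ≤ m → N ≤ n →
      ‖((u m - u n : domain) : Lp ℝ 2 μ)‖ ^ 2 + form (u m - u n) (u m - u n) < ε) →
    ∃ v : domain, Tendsto
      (fun n => ‖((u n - v : domain) : Lp ℝ 2 μ)‖ ^ 2 + form (u n - v) (u n - v)) atTop (𝓝 0)
  markov : ∀ u : domain, ∃ v : domain,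
    ((v : Lp ℝ 2 μ) : E → ℝ) =ᵐ[μ] (fun x => min (max (((u : Lp ℝ 2 μ) : E → ℝ) x) 0) 1) ∧
      form v v ≤ form u u

namespace DirichletForm

variable {E : Type*} [MeasurableSpace E] {μ : Measure E}

/-- `ℰ₁(u,u) = ‖u‖² + ℰ(u,u)`. -/
noncomputable def form₁ (ℰ : DirichletForm μ) (u : ℰ.domain) : ℝ :=
  ‖(u : Lp ℝ 2 μ)‖ ^ 2 + ℰ.form u u

/-- `1 ∈ 𝒟(ℰ)` and `ℰ(1,1) = 0`. -/
def IsConservative (ℰ : DirichletForm μ) : Prop :=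
  ∃ u : ℰ.domain, ((u : Lp ℝ 2 μ) : E → ℝ) =ᵐ[μ] (fun _ => (1 : ℝ)) ∧ ℰ.form u u = 0

end DirichletForm

theorem memLp_two_of_bounded {E : Type*} [MeasurableSpace E] {μ : Measure E} [IsFiniteMeasure μ]
    {f : E → ℝ} (hm : Measurable f) (hb : ∃ K : ℝ, ∀ x, |f x| ≤ K) : MemLp f 2 μ := by
  obtain ⟨K, hK⟩ := hb
  exact MemLp.of_bound hm.aestronglyMeasurable K (Eventually.of_forall hK)

/-- An algebra `𝒜` of bounded measurable functions, stable under composition with Lipschitz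
functions on `ℝ`, whose classes lie in the domain of the Dirichlet form. -/
structure LipschitzAlgebra {E : Type*} [MeasurableSpace E] {μ : Measure E} [IsFiniteMeasure μ]
    (ℰ : DirichletForm μ) where
  carrier : Submodule ℝ (E → ℝ)
  measurable : ∀ f ∈ carrier, Measurable f
  bounded : ∀ f ∈ carrier, ∃ K : ℝ, ∀ x, |f x| ≤ K
  mul_mem : ∀ f ∈ carrier, ∀ g ∈ carrier, (fun x => f x * g x) ∈ carrier
  lipschitz_comp_mem : ∀ f ∈ carrier, ∀ (φ : ℝ → ℝ) (K : ℝ≥0), LipschitzWith K φ →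
    (fun x => φ (f x)) ∈ carrier
  mem_domain : ∀ f, ∀ hf : f ∈ carrier,
    (memLp_two_of_bounded (μ := μ) (measurable f hf) (bounded f hf)).toLp f ∈ ℰ.domain

/-- A function of the algebra, seen as an element of the domain of the Dirichlet form. -/
noncomputable def LipschitzAlgebra.toDomain {E : Type*} [MeasurableSpace E] {μ : Measure E}
    [IsFiniteMeasure μ] {ℰ : DirichletForm μ} (𝒜 : LipschitzAlgebra ℰ) (f : 𝒜.carrier) :
    ℰ.domain :=
  ⟨(memLp_two_of_bounded (μ := μ) (𝒜.measurable f f.2) (𝒜.bounded f f.2)).toLp f,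
    𝒜.mem_domain f f.2⟩

/-- `φ ∈ C_b^∞(ℝ)`: smooth and bounded together with all its derivatives. -/
def IsSmoothBounded (φ : ℝ → ℝ) : Prop :=
  ContDiff ℝ ∞ φ ∧ ∀ k : ℕ, ∃ K : ℝ, ∀ t, |iteratedDeriv k φ t| ≤ K

/-- The structure making a Dirichlet form local: a core `𝒜` as above, dense in the domain for the
`ℰ₁`-norm, with a square field `Γ`, that is, a symmetric bilinear map from `𝒜 × 𝒜` to the bounded
measurable functions with `Γ(f,f) ≥ 0` and `ℰ(f,g) = μ(Γ(f,g))`, satisfying the chain rule and the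
Leibniz rule. Identities between the functions `Γ(f,g)` are understood almost everywhere; the values
of `gamma` outside `𝒜 × 𝒜` play no role. -/
structure SquareField {E : Type*} [MeasurableSpace E] {μ : Measure E} [IsFiniteMeasure μ]
    (ℰ : DirichletForm μ) extends LipschitzAlgebra ℰ where
  dense_carrier : ∀ u : ℰ.domain, ∀ ε : ℝ, 0 < ε →
    ∃ f : carrier, ℰ.form₁ (u - toLipschitzAlgebra.toDomain f) < ε
  gamma : (E → ℝ) → (E → ℝ) → E → ℝ
  gamma_measurable : ∀ f ∈ carrier, ∀ g ∈ carrier, Measurable (gamma f g)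
  gamma_bounded : ∀ f ∈ carrier, ∀ g ∈ carrier, ∃ K : ℝ, ∀ x, |gamma f g x| ≤ K
  gamma_symm : ∀ f ∈ carrier, ∀ g ∈ carrier, gamma f g =ᵐ[μ] gamma g f
  gamma_add : ∀ f ∈ carrier, ∀ g ∈ carrier, ∀ h ∈ carrier,
    gamma (f + g) h =ᵐ[μ] gamma f h + gamma g h
  gamma_smul : ∀ c : ℝ, ∀ f ∈ carrier, ∀ g ∈ carrier, gamma (c • f) g =ᵐ[μ] c • gamma f g
  gamma_nonneg : ∀ f ∈ carrier, ∀ᵐ x ∂μ, 0 ≤ gamma f f x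
  form_eq : ∀ f g : carrier,
    ℰ.form (toLipschitzAlgebra.toDomain f) (toLipschitzAlgebra.toDomain g) = ∫ x, gamma f g x ∂μ
  gamma_chain : ∀ f ∈ carrier, ∀ g ∈ carrier, ∀ φ : ℝ → ℝ, IsSmoothBounded φ →
    gamma (fun x => φ (f x)) g =ᵐ[μ] fun x => deriv φ (f x) * gamma f g x
  gamma_mul : ∀ f ∈ carrier, ∀ g ∈ carrier, ∀ h ∈ carrier,
    gamma (fun x => f x * g x) h =ᵐ[μ] fun x => g x * gamma f h x + f x * gamma g h x

/-- The truncation `f_n = min(n, max(f, -n))`. -/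
def truncation {E : Type*} (n : ℕ) (f : E → ℝ) : E → ℝ :=
  fun x => min (n : ℝ) (max (f x) (-(n : ℝ)))

namespace SquareField

variable {E : Type*} [MeasurableSpace E] {μ : Measure E} [IsFiniteMeasure μ] {ℰ : DirichletForm μ}

/-- `f ∈ 𝒜_loc`: all truncations of `f` lie in `𝒜`. -/
def MemLoc (G : SquareField ℰ) (f : E → ℝ) : Prop :=
  ∀ n : ℕ, truncation n f ∈ G.carrier

/-- The extension of `Γ` to `𝒜_loc`: at a point `x`, it is `Γ(f_n, g_n)(x)` for the first positive
integer `n` with `|f(x)| < n` and `|g(x)| < n` (by locality, any other such `n` gives the same value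
for almost every `x`). -/
noncomputable def gammaLoc (G : SquareField ℰ) (f g : E → ℝ) : E → ℝ :=
  fun x => G.gamma (truncation (⌊max |f x| |g x|⌋₊ + 1) f)
    (truncation (⌊max |f x| |g x|⌋₊ + 1) g) x

/-- The super Poincaré inequality
`μ(f²) ≤ r ℰ(f,f) + β(r) μ(|f|)²` for all `r > 0` and `f ∈ 𝒜`. -/
def SuperPoincare (G : SquareField ℰ) (β : ℝ → ℝ) : Prop :=
  ∀ r : ℝ, 0 < r → ∀ f : G.carrier,
    ∫ x, (f : E → ℝ) x ^ 2 ∂μ ≤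
      r * ℰ.form (G.toDomain f) (G.toDomain f) + β r * (∫ x, |(f : E → ℝ) x| ∂μ) ^ 2

/-- The Poincaré inequality `μ(f²) ≤ C₀ ℰ(f,f) + μ(f)²` for all `f ∈ 𝒜`. -/
def Poincare (G : SquareField ℰ) (C₀ : ℝ) : Prop :=
  ∀ f : G.carrier,
    ∫ x, (f : E → ℝ) x ^ 2 ∂μ ≤
      C₀ * ℰ.form (G.toDomain f) (G.toDomain f) + (∫ x, (f : E → ℝ) x ∂μ) ^ 2

/-- The weighted log-Sobolev inequality `μ(f² log f²) ≤ C μ(Γ(f,f) w)` for all `f ∈ 𝒜` with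
`μ(f²) = 1`. -/
def WeightedLogSobolev (G : SquareField ℰ) (w : E → ℝ) (C : ℝ) : Prop :=
  ∀ f ∈ G.carrier, ∫ x, f x ^ 2 ∂μ = 1 →
    ∫ x, f x ^ 2 * Real.log (f x ^ 2) ∂μ ≤ C * ∫ x, G.gamma f f x * w x ∂μ

end SquareField

/-- `β⁻¹(s) = inf {t : β(t) ≤ s}`, the infimum of the empty set being `∞`. As `β` is a continuous
decreasing function on `(0,∞)`, only `t > 0` is used; setting `β(0) = lim_{t → 0} β(t)` and admitting
`t = 0` gives the same infimum. -/
noncomputable def rateInv (β : ℝ → ℝ) (s : ℝ) : ℝ≥0∞ :=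
  ⨅ (t : ℝ) (_ : 0 < t ∧ β t ≤ s), ENNReal.ofReal t

/-- `η(s) = log(2s) (1 ∧ β⁻¹(s/2))`, used for `s ≥ 1`. -/
noncomputable def rateEta (β : ℝ → ℝ) (s : ℝ) : ℝ :=
  Real.log (2 * s) * (min 1 (rateInv β (s / 2))).toReal

/-- `α(s) = sup {η(t) : t ≥ μ(ϱ ≥ s - 2)⁻¹}`, with `0⁻¹ = ∞` and with supremum `0` over the empty
set (the latter occurs at `s = ϱ(x)` only for `x` in a null set). -/
noncomputable def weightAlpha {E : Type*} [MeasurableSpace E] (μ : Measure E) (β : ℝ → ℝ)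
    (ϱ : E → ℝ) (s : ℝ) : ℝ :=
  sSup (rateEta β '' {t : ℝ | (μ {x | s - 2 ≤ ϱ x})⁻¹ ≤ ENNReal.ofReal t})

/-! A function `g` supported in a set of measure at most `1/s`, `s ≥ 2`, has an improved spectral
gap. By Cauchy-Schwarz, `β(r) μ(|g|)² ≤ μ(g²)/2` as soon as `β(r) ≤ s/2`, so the super Poincaré
inequality gives `μ(g²) ≤ 2r μ(Γ(g,g))`; the Poincaré inequality accounts for the cap `1` in `η`.
Hence `log(2s) μ(g²) ≤ c η(s) μ(Γ(g,g))` (`log_mul_integral_sq_le`).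

The weight appears on cutting `u` along the shells `k-1 ≤ ϱ ≤ k+1`. The support of such a piece has
measure at most `μ(ϱ ≥ k-1)`, so the relevant `η` is at most `α(k+1)`, which is at most `α(ϱ)` on
the shell. As `Γ(ϱ,ϱ) ≤ 1`, the cut-offs cost only a multiple of `u²`, and the shells overlap
boundedly. Summation gives `log(2T) μ(u²) ≤ D (μ(Γ(u,u) α(ϱ)) + μ(u²))` when `u` has support of
measure at most `1/T`, with a version for the tail `ϱ ≥ k₀` (`exists_tail_inequality`). The error
term carries no logarithm, hence is absorbed for large `T`.

This is used twice. It makes the tail of `f` negligible, and combined with the Poincaré inequality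
for the cut-off part it yields a weighted Poincaré inequality (`exists_weighted_poincare`). Applied
to `f` cut at height `2^n`, whose support has measure at most `4^(-n)` when `μ(f²) = 1`, it bounds
`∑ n μ(f_n²)` (`exists_level_inequality`). The pointwise bound `sq_mul_log_sq_le` controls the
entropy by these two quantities.

The weighted Poincaré inequality divides by a value of `α`, which may vanish when `β` is bounded. In
that case letting `r → 0` shows that no nonzero function of the algebra has small support; then
every `f` is constant and its entropy is `0`. -/

/-! ### Smooth cut-off functions on the line -/

namespace IsSmoothBounded

theorem of_hasCompactSupport_deriv {φ : ℝ → ℝ} (hφ : ContDiff ℝ ∞ φ) (hb : ∃ K : ℝ, ∀ t, |φ t| ≤ K)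
    (hc : HasCompactSupport (deriv φ)) : IsSmoothBounded φ := by
  refine ⟨hφ, fun k => ?_⟩
  cases k with
  | zero => simpa using hb
  | succ k =>
    have hd : ContDiff ℝ ∞ (deriv φ) := (contDiff_infty_iff_deriv.1 hφ).2
    have hcont : Continuous (iteratedFDeriv ℝ k (deriv φ)) :=
      hd.continuous_iteratedFDeriv (by exact_mod_cast le_top)
    obtain ⟨K, hK⟩ := (hc.iteratedFDeriv (𝕜 := ℝ) k).exists_bound_of_continuous hcont
    refine ⟨K, fun t => ?_⟩
    rw [iteratedDeriv_succ', ← Real.norm_eq_abs, ← norm_iteratedFDeriv_eq_norm_iteratedDeriv]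
    exact hK t

theorem const (c : ℝ) : IsSmoothBounded fun _ => c := by
  refine of_hasCompactSupport_deriv contDiff_const ⟨|c|, fun _ => le_rfl⟩ ?_
  simp only [deriv_const']
  exact HasCompactSupport.zero

theorem exists_bound_deriv {φ : ℝ → ℝ} (h : IsSmoothBounded φ) :
    ∃ M : ℝ≥0, (∀ t, |deriv φ t| ≤ M) ∧ LipschitzWith M φ := by
  obtain ⟨M, hM⟩ := h.2 1
  rw [iteratedDeriv_one] at hM
  have hM0 : 0 ≤ M := (abs_nonneg _).trans (hM 0)
  refine ⟨⟨M, hM0⟩, hM, lipschitzWith_of_nnnorm_deriv_le (h.1.differentiable (by simp)) fun t => ?_⟩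
  exact_mod_cast hM t

/-- A smooth function which is locally constant off a compact interval. -/
theorem of_deriv_eq_zero {φ : ℝ → ℝ} (hφ : ContDiff ℝ ∞ φ) (hb : ∃ K : ℝ, ∀ t, |φ t| ≤ K)
    {a b : ℝ} (h : ∀ t, t ∉ Set.Icc a b → deriv φ t = 0) : IsSmoothBounded φ :=
  of_hasCompactSupport_deriv hφ hb (HasCompactSupport.intro isCompact_Icc h)

end IsSmoothBounded

theorem deriv_eq_zero_of_eqOn {φ : ℝ → ℝ} {c : ℝ} {U : Set ℝ} (hU : IsOpen U)
    (h : ∀ t ∈ U, φ t = c) {t : ℝ} (ht : t ∈ U) : deriv φ t = 0 := by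
  have : φ =ᶠ[𝓝 t] fun _ => c := by
    filter_upwards [hU.mem_nhds ht] with s hs using h s hs
  rw [this.deriv_eq, deriv_const]

/-- A smooth function on the line with values in `[0,1]`, equal to `1` on `[-1/2,1/2]` and
vanishing off `(-1,1)`. -/
noncomputable def smoothTent (t : ℝ) : ℝ := Real.smoothTransition ((1 - t ^ 2) * (4 / 3))

/-- A smooth function with values in `[0,1]`, vanishing on `[-1,1]` and equal to `1` off
`(-2,2)`. -/
noncomputable def smoothWell (t : ℝ) : ℝ := Real.smoothTransition ((t ^ 2 - 1) / 3)

/-- The smooth step which decreases from `1` at `a` to `0` at `b`. -/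
noncomputable def smoothStep (a b t : ℝ) : ℝ := Real.smoothTransition ((b - t) / (b - a))

theorem abs_smoothTransition_le (t : ℝ) : |Real.smoothTransition t| ≤ 1 := by
  rw [abs_of_nonneg (Real.smoothTransition.nonneg _)]
  exact Real.smoothTransition.le_one _

theorem smoothTent_eq_zero {t : ℝ} (ht : 1 ≤ |t|) : smoothTent t = 0 := by
  apply Real.smoothTransition.zero_of_nonpos
  have : 1 ≤ t ^ 2 := by rw [← sq_abs]; nlinarith
  nlinarith

theorem smoothTent_eq_one {t : ℝ} (ht : |t| ≤ 1 / 2) : smoothTent t = 1 := by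
  apply Real.smoothTransition.one_of_one_le
  have : t ^ 2 ≤ 1 / 4 := by rw [← sq_abs]; nlinarith [abs_nonneg t]
  nlinarith

theorem smoothTent_sq_le_one (t : ℝ) : smoothTent t ^ 2 ≤ 1 := by
  rw [sq_le_one_iff_abs_le_one]; exact abs_smoothTransition_le _

theorem contDiff_smoothTent : ContDiff ℝ ∞ smoothTent :=
  Real.smoothTransition.contDiff.comp (by fun_prop)

theorem contDiff_smoothWell : ContDiff ℝ ∞ smoothWell :=
  Real.smoothTransition.contDiff.comp (by fun_prop)

theorem contDiff_smoothStep (a b : ℝ) : ContDiff ℝ ∞ (smoothStep a b) :=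
  Real.smoothTransition.contDiff.comp (by fun_prop)

theorem smoothWell_eq_zero {t : ℝ} (ht : |t| ≤ 1) : smoothWell t = 0 := by
  apply Real.smoothTransition.zero_of_nonpos
  have : t ^ 2 ≤ 1 := by rw [← sq_abs]; nlinarith [abs_nonneg t]
  linarith

theorem smoothWell_eq_one {t : ℝ} (ht : 2 ≤ |t|) : smoothWell t = 1 := by
  apply Real.smoothTransition.one_of_one_le
  have : 4 ≤ t ^ 2 := by rw [← sq_abs]; nlinarith
  linarith

theorem smoothStep_eq_one {a b t : ℝ} (hab : a < b) (ht : t ≤ a) : smoothStep a b t = 1 := by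
  apply Real.smoothTransition.one_of_one_le
  rw [le_div_iff₀ (by linarith)]; linarith

theorem smoothStep_eq_zero {a b t : ℝ} (hab : a < b) (ht : b ≤ t) : smoothStep a b t = 0 := by
  apply Real.smoothTransition.zero_of_nonpos
  exact div_nonpos_of_nonpos_of_nonneg (by linarith) (by linarith)

theorem deriv_smoothStep_eq_zero {a b t : ℝ} (hab : a < b) (ht : t ∉ Set.Icc a b) :
    deriv (smoothStep a b) t = 0 := by
  rcases lt_or_ge t a with h | h
  · exact deriv_eq_zero_of_eqOn isOpen_Iio (fun s hs => smoothStep_eq_one hab (le_of_lt hs)) h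
  · have : b < t := by
      by_contra hc
      exact ht ⟨h, not_lt.1 hc⟩
    exact deriv_eq_zero_of_eqOn isOpen_Ioi (fun s hs => smoothStep_eq_zero hab (le_of_lt hs)) this

theorem isSmoothBounded_smoothStep {a b : ℝ} (hab : a < b) : IsSmoothBounded (smoothStep a b) :=
  .of_deriv_eq_zero (contDiff_smoothStep a b) ⟨1, fun _ => abs_smoothTransition_le _⟩
    fun _ ht => deriv_smoothStep_eq_zero hab ht

theorem deriv_smoothTent_eq_zero {t : ℝ} (ht : t ∉ Set.Icc (-1) (1 : ℝ)) :
    deriv smoothTent t = 0 := by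
  refine deriv_eq_zero_of_eqOn (c := 0) (isOpen_compl_iff.2 isClosed_Icc) (fun s hs => ?_) ht
  apply smoothTent_eq_zero
  by_contra hc
  exact hs (abs_le.1 (le_of_lt (not_le.1 hc)))

theorem isSmoothBounded_smoothTent_sub (k : ℝ) : IsSmoothBounded fun t => smoothTent (t - k) := by
  refine .of_deriv_eq_zero (a := k - 1) (b := k + 1) (contDiff_smoothTent.comp (by fun_prop))
    ⟨1, fun _ => abs_smoothTransition_le _⟩ fun t ht => ?_
  rw [deriv_comp_sub_const]
  apply deriv_smoothTent_eq_zero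
  intro h
  exact ht ⟨by linarith [h.1], by linarith [h.2]⟩

theorem deriv_smoothWell_eq_zero {t : ℝ} (ht : ¬ (1 ≤ |t| ∧ |t| < 2)) : deriv smoothWell t = 0 := by
  rcases lt_or_ge (|t|) 1 with h | h
  · exact deriv_eq_zero_of_eqOn (isOpen_lt continuous_abs continuous_const)
      (fun s hs => smoothWell_eq_zero (le_of_lt hs)) h
  · have h2 : 2 ≤ |t| := by
      by_contra hc
      exact ht ⟨h, not_le.1 hc⟩
    -- At `|t| = 2` the function is not locally constant; the derivative vanishes there because the
    -- maximal value `1` is attained. This allows the half-open, hence disjoint, dyadic shells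
    -- below.
    have hmax : IsLocalMax smoothWell t := by
      refine Eventually.of_forall fun s => ?_
      rw [smoothWell_eq_one h2]
      exact Real.smoothTransition.le_one _
    exact hmax.deriv_eq_zero

theorem exists_deriv_smoothTent_bound : ∃ M : ℝ, 0 < M ∧ ∀ t, |deriv smoothTent t| ≤ M := by
  have h := isSmoothBounded_smoothTent_sub 0
  simp only [sub_zero] at h
  obtain ⟨M, hM, -⟩ := h.exists_bound_deriv
  exact ⟨M + 1, by positivity, fun t => (hM t).trans (by linarith)⟩

/-- The dyadic level function at level `2 ^ n`. -/
noncomputable def dyadicLevel (n : ℕ) (t : ℝ) : ℝ := 2 ^ n * smoothWell (t / 2 ^ n)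

theorem deriv_dyadicLevel (n : ℕ) (t : ℝ) : deriv (dyadicLevel n) t = deriv smoothWell (t / 2 ^ n) := by
  have h : HasDerivAt smoothWell (deriv smoothWell (t / 2 ^ n)) (t / 2 ^ n) :=
    (contDiff_smoothWell.differentiable (by simp) _).hasDerivAt
  have h2 := (h.comp t ((hasDerivAt_id t).div_const (2 ^ n))).const_mul ((2 : ℝ) ^ n)
  refine h2.deriv.trans ?_
  field_simp

theorem deriv_dyadicLevel_eq_zero {n : ℕ} {t : ℝ} (ht : ¬ (2 ^ n ≤ |t| ∧ |t| < 2 ^ (n + 1))) :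
    deriv (dyadicLevel n) t = 0 := by
  rw [deriv_dyadicLevel]
  apply deriv_smoothWell_eq_zero
  have h2 : (0 : ℝ) < 2 ^ n := by positivity
  rw [abs_div, abs_of_pos h2, le_div_iff₀ h2, div_lt_iff₀ h2]
  rw [pow_succ'] at ht
  simpa using ht

theorem dyadicLevel_eq_zero {n : ℕ} {t : ℝ} (ht : |t| ≤ 2 ^ n) : dyadicLevel n t = 0 := by
  have h2 : (0 : ℝ) < 2 ^ n := by positivity
  rw [dyadicLevel, smoothWell_eq_zero, mul_zero]
  rw [abs_div, abs_of_pos h2, div_le_iff₀ h2]; simpa using ht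

theorem dyadicLevel_eq {n : ℕ} {t : ℝ} (ht : 2 ^ (n + 1) ≤ |t|) : dyadicLevel n t = 2 ^ n := by
  have h2 : (0 : ℝ) < 2 ^ n := by positivity
  rw [dyadicLevel, smoothWell_eq_one, mul_one]
  rw [abs_div, abs_of_pos h2, le_div_iff₀ h2, ← pow_succ']; exact ht

theorem isSmoothBounded_dyadicLevel (n : ℕ) : IsSmoothBounded (dyadicLevel n) := by
  refine .of_deriv_eq_zero (a := -2 ^ (n + 1)) (b := 2 ^ (n + 1))
    (contDiff_const.mul (contDiff_smoothWell.comp (by fun_prop)))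
    ⟨2 ^ n, fun t => ?_⟩ fun t ht => deriv_dyadicLevel_eq_zero fun h => ht (abs_le.1 h.2.le)
  rw [dyadicLevel, abs_mul, abs_of_pos (by positivity : (0 : ℝ) < 2 ^ n)]
  exact mul_le_of_le_one_right (by positivity) (abs_smoothTransition_le _)

/-- The scaling `2^n w(t/2^n)` leaves the supremum of the derivative unchanged, so one bound serves
all levels. -/
theorem exists_deriv_dyadicLevel_bound :
    ∃ M : ℝ, 0 < M ∧ ∀ n t, |deriv (dyadicLevel n) t| ≤ M := by
  obtain ⟨M, hM, -⟩ := (isSmoothBounded_dyadicLevel 0).exists_bound_deriv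
  refine ⟨M + 1, by positivity, fun n t => ?_⟩
  have := hM (t / 2 ^ n)
  rw [deriv_dyadicLevel] at this ⊢
  simp only [pow_zero, div_one] at this
  linarith

/-- A smooth bounded function vanishing on `[n,∞)` whose derivative vanishes nowhere on
`[0,n)`. -/
theorem exists_isSmoothBounded_deriv_ne_zero (n : ℝ) : ∃ φ : ℝ → ℝ, IsSmoothBounded φ ∧
    (∀ t, n ≤ t → φ t = 0) ∧ ∀ t, 0 ≤ t → t < n → deriv φ t ≠ 0 := by
  have hst : ∀ t : ℝ, t ≤ -2 → smoothStep (-2) (-1) t = 1 := fun t ht =>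
    smoothStep_eq_one (by norm_num) ht
  -- The first factor is flat at `n` and strictly monotone before it; the second only truncates at
  -- negative arguments, for boundedness, and equals `1` on `[-1,∞)`.
  set φ : ℝ → ℝ := fun t => expNegInvGlue (n - t) * (1 - smoothStep (-2) (-1) t) with hφ
  have hz : ∀ t, n ≤ t → φ t = 0 := fun t ht => by
    simp only [hφ]
    rw [expNegInvGlue.zero_of_nonpos (by linarith), zero_mul]
  have hz' : ∀ t, t ≤ -2 → φ t = 0 := fun t ht => by simp only [hφ]; rw [hst t ht]; ring
  have hc : ContDiff ℝ ∞ φ :=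
    (expNegInvGlue.contDiff.comp (by fun_prop)).mul (contDiff_const.sub (contDiff_smoothStep _ _))
  have hd : ∀ t, t ∉ Set.Icc (-2) n → deriv φ t = 0 := fun t ht => by
    rcases lt_or_ge t (-2) with h | h
    · exact deriv_eq_zero_of_eqOn isOpen_Iio (fun s hs => hz' s (le_of_lt hs)) h
    · have : n < t := by
        by_contra hc
        exact ht ⟨h, not_lt.1 hc⟩
      exact deriv_eq_zero_of_eqOn isOpen_Ioi (fun s hs => hz s (le_of_lt hs)) this
  refine ⟨φ, .of_deriv_eq_zero hc ?_ hd, hz, fun t h0 ht => ?_⟩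
  · obtain ⟨K, hK⟩ := (HasCompactSupport.intro (isCompact_Icc (a := -2) (b := n)) (f := φ)
      fun t ht => by
        by_contra hne
        refine ht ⟨?_, ?_⟩
        · by_contra hlt
          exact hne (hz' t (le_of_lt (not_le.1 hlt)))
        · by_contra hlt
          exact hne (hz t (le_of_lt (not_le.1 hlt)))).exists_bound_of_continuous hc.continuous
    exact ⟨K, hK⟩
  · have hev : φ =ᶠ[𝓝 t] fun t => Real.exp (-(n - t)⁻¹) := by
      filter_upwards [Ioo_mem_nhds (show (-1 : ℝ) < t by linarith) ht] with s hs
      simp only [hφ]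
      rw [smoothStep_eq_zero (by norm_num) hs.1.le, expNegInvGlue, if_neg (by linarith [hs.2])]
      ring
    have hne : n - t ≠ 0 := by linarith
    have h1 : HasDerivAt (fun t => Real.exp (-(n - t)⁻¹)) _ t :=
      (((hasDerivAt_id t).const_sub n).inv hne).neg.exp
    rw [hev.deriv_eq, h1.deriv]
    simp only [id]
    have : (n - t) ^ 2 ≠ 0 := pow_ne_zero _ hne
    have := Real.exp_ne_zero (-(n - t)⁻¹)
    simp [*]

/-- Bounded measurable real functions. -/
structure IsBoundedMeasurable {E : Type*} [MeasurableSpace E] (f : E → ℝ) : Prop where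
  measurable : Measurable f
  bounded : ∃ K : ℝ, ∀ x, |f x| ≤ K

/-! ### Stability properties of bounded measurable functions -/

namespace IsBoundedMeasurable

variable {E : Type*} [MeasurableSpace E] {f g : E → ℝ}

theorem integrable (hf : IsBoundedMeasurable f) (μ : Measure E) [IsFiniteMeasure μ] :
    Integrable f μ := by
  obtain ⟨K, hK⟩ := hf.bounded
  exact Integrable.of_bound hf.measurable.aestronglyMeasurable K (Eventually.of_forall hK)

theorem const (c : ℝ) : IsBoundedMeasurable fun _ : E => c :=
  ⟨measurable_const, |c|, fun _ => le_rfl⟩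

theorem add (hf : IsBoundedMeasurable f) (hg : IsBoundedMeasurable g) :
    IsBoundedMeasurable fun x => f x + g x := by
  obtain ⟨K, hK⟩ := hf.bounded
  obtain ⟨L, hL⟩ := hg.bounded
  exact ⟨hf.measurable.add hg.measurable, K + L,
    fun x => (abs_add_le _ _).trans (add_le_add (hK x) (hL x))⟩

theorem mul (hf : IsBoundedMeasurable f) (hg : IsBoundedMeasurable g) :
    IsBoundedMeasurable fun x => f x * g x := by
  obtain ⟨K, hK⟩ := hf.bounded
  obtain ⟨L, hL⟩ := hg.bounded
  refine ⟨hf.measurable.mul hg.measurable, K * L, fun x => ?_⟩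
  rw [abs_mul]
  exact mul_le_mul (hK x) (hL x) (abs_nonneg _) ((abs_nonneg _).trans (hK x))

theorem pow (hf : IsBoundedMeasurable f) (n : ℕ) : IsBoundedMeasurable fun x => f x ^ n := by
  obtain ⟨K, hK⟩ := hf.bounded
  refine ⟨hf.measurable.pow_const n, K ^ n, fun x => ?_⟩
  rw [abs_pow]
  exact pow_le_pow_left₀ (abs_nonneg _) (hK x) n

theorem neg (hf : IsBoundedMeasurable f) : IsBoundedMeasurable fun x => -f x := by
  obtain ⟨K, hK⟩ := hf.bounded
  exact ⟨hf.measurable.neg, K, fun x => by rw [abs_neg]; exact hK x⟩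

theorem sub (hf : IsBoundedMeasurable f) (hg : IsBoundedMeasurable g) :
    IsBoundedMeasurable fun x => f x - g x := by
  simpa only [sub_eq_add_neg] using hf.add hg.neg

theorem abs (hf : IsBoundedMeasurable f) : IsBoundedMeasurable fun x => |f x| := by
  obtain ⟨K, hK⟩ := hf.bounded
  exact ⟨measurable_norm.comp hf.measurable, K, fun x => by rw [abs_abs]; exact hK x⟩

theorem sum {ι : Type*} {s : Finset ι} {F : ι → E → ℝ} (h : ∀ i ∈ s, IsBoundedMeasurable (F i)) :
    IsBoundedMeasurable fun x => ∑ i ∈ s, F i x := by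
  classical
  induction s using Finset.induction_on with
  | empty => simpa using const 0
  | insert a s ha ih =>
    simp only [Finset.sum_insert ha]
    exact (h a (Finset.mem_insert_self _ _)).add
      (ih fun i hi => h i (Finset.mem_insert_of_mem hi))

theorem indicator_one {S : Set ℝ} (hS : MeasurableSet S) {ϱ : E → ℝ} (hϱ : Measurable ϱ) :
    IsBoundedMeasurable fun x => S.indicator 1 (ϱ x) := by
  refine ⟨(measurable_const.indicator hS).comp hϱ, 1, fun x => ?_⟩
  by_cases h : ϱ x ∈ S <;> simp [h]

theorem comp_continuous (hf : IsBoundedMeasurable f) {φ : ℝ → ℝ} (hφ : Continuous φ) :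
    IsBoundedMeasurable fun x => φ (f x) := by
  obtain ⟨K, hK⟩ := hf.bounded
  obtain ⟨L, hL⟩ := (isCompact_Icc (a := -K) (b := K)).exists_bound_of_continuousOn
    hφ.continuousOn
  exact ⟨hφ.measurable.comp hf.measurable, L, fun x => hL _ (abs_le.1 (hK x))⟩

end IsBoundedMeasurable

/-! ### Calculus of the square field -/

namespace SquareField

variable {E : Type*} [MeasurableSpace E] {μ : Measure E} [IsFiniteMeasure μ] {ℰ : DirichletForm μ}
  (G : SquareField ℰ) {f g u v : E → ℝ}

theorem isBoundedMeasurable (hf : f ∈ G.carrier) : IsBoundedMeasurable f :=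
  ⟨G.measurable f hf, G.bounded f hf⟩

theorem isBoundedMeasurable_gamma (hf : f ∈ G.carrier) (hg : g ∈ G.carrier) :
    IsBoundedMeasurable (G.gamma f g) :=
  ⟨G.gamma_measurable f hf g hg, G.gamma_bounded f hf g hg⟩

theorem comp_mem (hf : f ∈ G.carrier) {φ : ℝ → ℝ} (hφ : IsSmoothBounded φ) :
    (fun x => φ (f x)) ∈ G.carrier := by
  obtain ⟨M, -, hM⟩ := hφ.exists_bound_deriv
  exact G.lipschitz_comp_mem f hf φ M hM

theorem const_mem (c : ℝ) : (fun _ => c) ∈ G.carrier :=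
  G.comp_mem (f := 0) G.carrier.zero_mem (IsSmoothBounded.const c)

theorem gamma_comp_self (hf : f ∈ G.carrier) {φ : ℝ → ℝ} (hφ : IsSmoothBounded φ) :
    G.gamma (fun x => φ (f x)) (fun x => φ (f x)) =ᵐ[μ]
      fun x => deriv φ (f x) ^ 2 * G.gamma f f x := by
  have hφf := G.comp_mem hf hφ
  filter_upwards [G.gamma_chain f hf _ hφf φ hφ, G.gamma_symm f hf _ hφf,
    G.gamma_chain f hf f hf φ hφ] with x h1 h2 h3
  rw [h1, h2, h3]; ring

theorem gamma_const_left (c : ℝ) (hg : g ∈ G.carrier) :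
    G.gamma (fun _ => c) g =ᵐ[μ] 0 := by
  filter_upwards [G.gamma_chain 0 G.carrier.zero_mem g hg _ (IsSmoothBounded.const c)] with x h
  simpa using h

theorem sub_const_mem (hf : f ∈ G.carrier) (c : ℝ) : (fun x => f x - c) ∈ G.carrier :=
  G.carrier.sub_mem hf (G.const_mem c)

theorem gamma_add_right (hf : f ∈ G.carrier) (hg : g ∈ G.carrier) (hu : u ∈ G.carrier) :
    G.gamma f (g + u) =ᵐ[μ] G.gamma f g + G.gamma f u := by
  filter_upwards [G.gamma_symm f hf _ (G.carrier.add_mem hg hu), G.gamma_add g hg u hu f hf,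
    G.gamma_symm f hf g hg, G.gamma_symm f hf u hu] with x h1 h2 h3 h4
  rw [h1, h2, Pi.add_apply, Pi.add_apply, h3, h4]

theorem gamma_sub_const_self (hf : f ∈ G.carrier) (c : ℝ) :
    G.gamma (fun x => f x - c) (fun x => f x - c) =ᵐ[μ] G.gamma f f := by
  have heq : (fun x => f x - c) = f + fun _ => -c := by ext x; simp [sub_eq_add_neg]
  have hc := G.const_mem (-c)
  have hs := G.carrier.add_mem hf hc
  rw [heq]
  filter_upwards [G.gamma_add f hf _ hc _ hs, G.gamma_const_left (-c) hs,
    G.gamma_add_right hf hf hc, G.gamma_symm f hf _ hc, G.gamma_const_left (-c) hf]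
    with x h1 h2 h3 h4 h5
  rw [h1, Pi.add_apply, h2, h3, Pi.add_apply, h4, h5]
  simp

/-- Discriminant argument for `q ↦ Γ(qu+v, qu+v)`. Nonnegativity holds off a null set depending on
`q`, so it is used for rational `q` only and extended by continuity. -/
theorem ae_gamma_sq_le (hu : u ∈ G.carrier) (hv : v ∈ G.carrier) :
    ∀ᵐ x ∂μ, G.gamma u v x ^ 2 ≤ G.gamma u u x * G.gamma v v x := by
  have key : ∀ q : ℚ, ∀ᵐ x ∂μ,
      0 ≤ G.gamma u u x * ((q : ℝ) * q) + 2 * G.gamma u v x * q + G.gamma v v x := fun q => by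
    have hqu := G.carrier.smul_mem (q : ℝ) hu
    have hs := G.carrier.add_mem hqu hv
    filter_upwards [G.gamma_nonneg _ hs, G.gamma_add _ hqu v hv _ hs, G.gamma_smul q u hu _ hs,
      G.gamma_add_right hu hqu hv, G.gamma_symm u hu _ hqu, G.gamma_smul q u hu u hu,
      G.gamma_add_right hv hqu hv, G.gamma_symm v hv _ hqu, G.gamma_smul q u hu v hv]
      with x h0 h1 h2 h3 h4 h5 h6 h7 h8
    simp only [h1, h2, h3, h4, h5, h6, h7, h8, Pi.add_apply, Pi.smul_apply, smul_eq_mul] at h0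
    linarith
  filter_upwards [ae_all_iff.2 key] with x hx
  have hreal : ∀ r : ℝ,
      0 ≤ G.gamma u u x * (r * r) + 2 * G.gamma u v x * r + G.gamma v v x := fun r =>
    Rat.denseRange_cast.induction_on (p := fun r : ℝ =>
        0 ≤ G.gamma u u x * (r * r) + 2 * G.gamma u v x * r + G.gamma v v x) r
      (isClosed_le continuous_const (by fun_prop)) hx
  have := discrim_le_zero hreal
  rw [discrim] at this
  linarith

/-- The Leibniz rule applied twice, the cross term `2uvΓ(u,v)` being absorbed by Cauchy-Schwarz. -/
theorem ae_gamma_mul_self_le (hu : u ∈ G.carrier) (hv : v ∈ G.carrier) :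
    ∀ᵐ x ∂μ, G.gamma (fun x => u x * v x) (fun x => u x * v x) x ≤
      2 * (v x ^ 2 * G.gamma u u x) + 2 * (u x ^ 2 * G.gamma v v x) := by
  have huv := G.mul_mem u hu v hv
  filter_upwards [G.gamma_mul u hu v hv _ huv, G.gamma_symm u hu _ huv, G.gamma_symm v hv _ huv,
    G.gamma_mul u hu v hv u hu, G.gamma_mul u hu v hv v hv, G.gamma_symm v hv u hu,
    G.ae_gamma_sq_le hu hv, G.gamma_nonneg u hu, G.gamma_nonneg v hv]
    with x h1 h2 h3 h4 h5 h6 hcs hu0 hv0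
  rw [h1, h2, h3, h4, h5, h6]
  have hA : 0 ≤ v x ^ 2 * G.gamma u u x := by positivity
  have hB : 0 ≤ u x ^ 2 * G.gamma v v x := by positivity
  have hsq : (2 * (u x * v x * G.gamma u v x)) ^ 2 ≤
      (v x ^ 2 * G.gamma u u x + u x ^ 2 * G.gamma v v x) ^ 2 := by
    have := mul_le_mul_of_nonneg_left hcs (sq_nonneg (u x * v x))
    nlinarith [sq_nonneg (v x ^ 2 * G.gamma u u x - u x ^ 2 * G.gamma v v x)]
  have := abs_le_of_sq_le_sq' hsq (by positivity)
  linarith [this.2]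

theorem integral_sq_le_of_poincare {C₀ : ℝ} (hP : G.Poincare C₀) (hf : f ∈ G.carrier) :
    ∫ x, f x ^ 2 ∂μ ≤ C₀ * ∫ x, G.gamma f f x ∂μ + (∫ x, f x ∂μ) ^ 2 := by
  have := hP ⟨f, hf⟩
  rwa [G.form_eq] at this

theorem integral_sq_le_of_superPoincare {β : ℝ → ℝ} (hP : G.SuperPoincare β) {r : ℝ} (hr : 0 < r)
    (hf : f ∈ G.carrier) :
    ∫ x, f x ^ 2 ∂μ ≤ r * ∫ x, G.gamma f f x ∂μ + β r * (∫ x, |f x| ∂μ) ^ 2 := by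
  have := hP r hr ⟨f, hf⟩
  rwa [G.form_eq] at this

end SquareField

/-! ### Smooth functions of `ϱ`, and functions with small support -/

theorem truncation_of_nonneg {E : Type*} {ϱ : E → ℝ} (hϱ_nonneg : ∀ x, 0 ≤ ϱ x) (n : ℕ) (x : E) :
    truncation n ϱ x = min (n : ℝ) (ϱ x) := by
  have : (0 : ℝ) ≤ n := n.cast_nonneg
  rw [truncation, max_eq_left (by linarith [hϱ_nonneg x])]

namespace SquareField

variable {E : Type*} [MeasurableSpace E] {μ : Measure E} [IsFiniteMeasure μ] {ℰ : DirichletForm μ}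
  {G : SquareField ℰ} {ϱ f g u : E → ℝ}

theorem MemLoc.measurable (hϱ : G.MemLoc ϱ) (hϱ_nonneg : ∀ x, 0 ≤ ϱ x) : Measurable ϱ := by
  refine measurable_of_tendsto_metrizable (fun n => G.measurable _ (hϱ n)) ?_
  rw [tendsto_pi_nhds]
  intro x
  obtain ⟨N, hN⟩ := exists_nat_ge (ϱ x)
  refine tendsto_const_nhds.congr' ?_
  filter_upwards [eventually_ge_atTop N] with n hn
  rw [truncation_of_nonneg hϱ_nonneg, min_eq_right (hN.trans (by exact_mod_cast hn))]

/-- Locality comes from the chain rule: a function `φ` constant on `[n,∞)` does not distinguish the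
two truncations, so both energies agree after multiplication by `φ'(ϱ)²`, which can be cancelled
where `ϱ < n`. -/
theorem MemLoc.ae_gamma_truncation_eq (hϱ : G.MemLoc ϱ) (hϱ_nonneg : ∀ x, 0 ≤ ϱ x) {n N : ℕ}
    (hnN : n ≤ N) : ∀ᵐ x ∂μ, ϱ x < n →
      G.gamma (truncation n ϱ) (truncation n ϱ) x = G.gamma (truncation N ϱ) (truncation N ϱ) x := by
  obtain ⟨φ, hφ, hz, hne⟩ := exists_isSmoothBounded_deriv_ne_zero n
  have hnN' : (n : ℝ) ≤ N := by exact_mod_cast hnN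
  have heq : (fun x => φ (truncation n ϱ x)) = fun x => φ (truncation N ϱ x) := by
    ext x
    rw [truncation_of_nonneg hϱ_nonneg, truncation_of_nonneg hϱ_nonneg]
    rcases le_total (n : ℝ) (ϱ x) with h | h
    · rw [min_eq_left h, hz _ le_rfl, hz _ (le_min hnN' h)]
    · rw [min_eq_right h, min_eq_right (h.trans hnN')]
  have h1 := G.gamma_comp_self (hϱ n) hφ
  have h2 := G.gamma_comp_self (hϱ N) hφ
  rw [heq] at h1
  filter_upwards [h1, h2] with x h1 h2 hx
  rw [h1, truncation_of_nonneg hϱ_nonneg, truncation_of_nonneg hϱ_nonneg, min_eq_right hx.le,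
    min_eq_right (hx.le.trans hnN')] at h2
  exact mul_left_cancel₀ (pow_ne_zero 2 (hne _ (hϱ_nonneg x) hx)) h2

theorem MemLoc.ae_gamma_truncation_le (hϱ : G.MemLoc ϱ) (hϱ_nonneg : ∀ x, 0 ≤ ϱ x)
    (hΓϱ : ∀ᵐ x ∂μ, G.gammaLoc ϱ ϱ x ≤ 1) (N : ℕ) :
    ∀ᵐ x ∂μ, ϱ x < N → G.gamma (truncation N ϱ) (truncation N ϱ) x ≤ 1 := by
  have key : ∀ n : ℕ, ∀ᵐ x ∂μ, n ≤ N → ϱ x < n →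
      G.gamma (truncation n ϱ) (truncation n ϱ) x =
        G.gamma (truncation N ϱ) (truncation N ϱ) x := fun n => by
    by_cases h : n ≤ N
    · filter_upwards [hϱ.ae_gamma_truncation_eq hϱ_nonneg h] with x hx _ using hx
    · exact Eventually.of_forall fun x hx => absurd hx h
  filter_upwards [ae_all_iff.2 key, hΓϱ] with x hx h1 hN
  have hlt : ϱ x < (⌊ϱ x⌋₊ + 1 : ℕ) := by exact_mod_cast Nat.lt_floor_add_one (ϱ x)
  have hle : ⌊ϱ x⌋₊ + 1 ≤ N := (Nat.floor_lt (hϱ_nonneg x)).2 hN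
  rw [gammaLoc, max_self, abs_of_nonneg (hϱ_nonneg x), hx _ hle hlt] at h1
  exact h1

/-- Composition of a locally Lipschitz function with a smooth function which is constant near
infinity. -/
theorem MemLoc.comp_mem_and_gamma_le (hϱ : G.MemLoc ϱ) (hϱ_nonneg : ∀ x, 0 ≤ ϱ x)
    (hΓϱ : ∀ᵐ x ∂μ, G.gammaLoc ϱ ϱ x ≤ 1) {φ : ℝ → ℝ} (hφ : IsSmoothBounded φ) {b c : ℝ}
    (hb : ∀ t, b ≤ t → φ t = c) :
    (fun x => φ (ϱ x)) ∈ G.carrier ∧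
      ∀ᵐ x ∂μ, G.gamma (fun x => φ (ϱ x)) (fun x => φ (ϱ x)) x ≤ deriv φ (ϱ x) ^ 2 := by
  -- Strictly above `b`, so that `φ'(N) = 0`: this settles the set `ϱ ≥ N`, on which the energy of
  -- the truncation at `N` is not known to be at most `1`.
  obtain ⟨N, hN⟩ := exists_nat_gt b
  have heq : (fun x => φ (ϱ x)) = fun x => φ (truncation N ϱ x) := by
    ext x
    rw [truncation_of_nonneg hϱ_nonneg]
    rcases le_total (N : ℝ) (ϱ x) with h | h
    · rw [min_eq_left h, hb _ hN.le, hb _ (hN.le.trans h)]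
    · rw [min_eq_right h]
  rw [heq]
  refine ⟨G.comp_mem (hϱ N) hφ, ?_⟩
  filter_upwards [G.gamma_comp_self (hϱ N) hφ, hϱ.ae_gamma_truncation_le hϱ_nonneg hΓϱ N]
    with x h1 h2
  rw [h1, truncation_of_nonneg hϱ_nonneg]
  rcases lt_or_ge (ϱ x) N with h | h
  · rw [min_eq_right h.le]
    exact mul_le_of_le_one_right (sq_nonneg _) (h2 h)
  · rw [min_eq_left h, deriv_eq_zero_of_eqOn isOpen_Ioi (fun s hs => hb s (le_of_lt hs)) hN]
    simpa using sq_nonneg _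

/-- The Cauchy-Schwarz inequality for a function supported on a set of measure at most `1/s`. -/
theorem sq_integral_le_of_support (hf : IsBoundedMeasurable f) {s : ℝ} (hs : 0 < s)
    (hsupp : μ {x | f x ≠ 0} ≤ ENNReal.ofReal (1 / s)) :
    s * (∫ x, f x ∂μ) ^ 2 ≤ ∫ x, f x ^ 2 ∂μ := by
  set S : Set ℝ := {0}ᶜ with hS
  have hSm : MeasurableSet S := (measurableSet_singleton 0).compl
  set I := ∫ x, f x ∂μ with hI
  have hind := IsBoundedMeasurable.indicator_one hSm hf.measurable
  have hm : ∫ x, S.indicator 1 (f x) ∂μ ≤ 1 / s := by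
    have h1 : (fun x => S.indicator (1 : ℝ → ℝ) (f x)) = (f ⁻¹' S).indicator 1 := by
      ext x; by_cases h : f x ∈ S <;> simp [Set.indicator, h]
    rw [h1, integral_indicator_one (hf.measurable hSm), measureReal_def]
    exact ENNReal.toReal_le_of_le_ofReal (by positivity) hsupp
  -- Cauchy-Schwarz by completing the square: `sI` is the optimal multiple of the indicator of the
  -- support when that support has measure `1/s`.
  have hnn : 0 ≤ ∫ x, (f x - s * I * S.indicator 1 (f x)) ^ 2 ∂μ :=
    integral_nonneg fun x => sq_nonneg _
  have hexp : ∀ x, (f x - s * I * S.indicator 1 (f x)) ^ 2 =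
      f x ^ 2 - 2 * s * I * f x + (s * I) ^ 2 * S.indicator 1 (f x) := fun x => by
    by_cases h : f x = 0
    · simp [hS, h]
    · have : f x ∈ S := h
      simp only [Set.indicator_of_mem this, Pi.one_apply]; ring
  simp only [hexp] at hnn
  rw [integral_add, integral_sub, integral_const_mul, integral_const_mul, ← hI] at hnn
  · have h2 := mul_le_mul_of_nonneg_left hm (sq_nonneg (s * I))
    have h3 : (s * I) ^ 2 * (1 / s) = s * I ^ 2 := by field_simp
    nlinarith
  · exact (hf.pow 2).integrable μ
  · exact (hf.integrable μ).const_mul _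
  · exact ((hf.pow 2).integrable μ).sub ((hf.integrable μ).const_mul _)
  · exact (hind.integrable μ).const_mul _

theorem integral_gamma_nonneg (hf : f ∈ G.carrier) : 0 ≤ ∫ x, G.gamma f f x ∂μ :=
  integral_nonneg_of_ae (G.gamma_nonneg f hf)

/-- The spectral gap inequality for functions with small support. -/
theorem log_mul_integral_sq_le {C₀ : ℝ} (hP : G.Poincare C₀) {β : ℝ → ℝ}
    (hSP : G.SuperPoincare β) (hg : g ∈ G.carrier) {s : ℝ} (hs : 2 ≤ s)
    (hsupp : μ {x | g x ≠ 0} ≤ ENNReal.ofReal (1 / s)) :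
    Real.log (2 * s) * ∫ x, g x ^ 2 ∂μ ≤
      2 * max 1 C₀ * rateEta β s * ∫ x, G.gamma g g x ∂μ := by
  have hs0 : 0 < s := by linarith
  have hgb := G.isBoundedMeasurable hg
  have hcs := sq_integral_le_of_support hgb hs0 hsupp
  have hcs' := sq_integral_le_of_support hgb.abs hs0 (by simpa using hsupp)
  simp only [sq_abs] at hcs'
  set V := ∫ x, g x ^ 2 ∂μ
  set D := ∫ x, G.gamma g g x ∂μ
  have hD : 0 ≤ D := integral_gamma_nonneg hg
  -- Here `s ≥ 2` enters: `μ(g)² ≤ V/s ≤ V/2` is absorbed on the left.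
  have h1 : V ≤ 2 * C₀ * D := by
    have := G.integral_sq_le_of_poincare hP hg
    nlinarith [sq_nonneg (∫ x, g x ∂μ)]
  have h2 : ∀ r, 0 < r → β r ≤ s / 2 → V ≤ 2 * r * D := fun r hr hβ => by
    have := G.integral_sq_le_of_superPoincare hSP hr hg
    nlinarith [mul_le_mul_of_nonneg_right hβ (sq_nonneg (∫ x, |g x| ∂μ))]
  set ρ : ℝ≥0∞ := min 1 (rateInv β (s / 2)) with hρ
  have hρtop : ρ ≠ ⊤ := ((min_le_left _ _).trans_lt ENNReal.one_lt_top).ne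
  have h3 : V ≤ 2 * max 1 C₀ * ρ.toReal * D := by
    rcases le_or_gt 1 (rateInv β (s / 2)) with h | h
    · rw [hρ, min_eq_left h, ENNReal.toReal_one]
      have := mul_le_mul_of_nonneg_right (le_max_right 1 C₀) hD
      nlinarith
    -- The infimum defining `β⁻¹(s/2)` need not be attained among positive `r`, so it is approached
    -- from above.
    · have hinf : ∀ ε : ℝ, 0 < ε → V ≤ 2 * (ρ.toReal + ε) * D := fun ε hε => by
        have hlt : rateInv β (s / 2) < ENNReal.ofReal (ρ.toReal + ε) := by
          rw [ENNReal.ofReal_add ENNReal.toReal_nonneg hε.le, ENNReal.ofReal_toReal hρtop, hρ,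
            min_eq_right h.le]
          exact ENNReal.lt_add_right h.ne_top (by simpa using hε)
        simp only [rateInv, iInf_lt_iff] at hlt
        obtain ⟨r, ⟨hr, hβ⟩, hlt⟩ := hlt
        have := (ENNReal.ofReal_lt_ofReal_iff (by positivity)).1 hlt
        have := h2 r hr hβ
        nlinarith
      have h4 : V ≤ 2 * ρ.toReal * D := by
        refine ge_of_tendsto (x := 𝓝[>] (0 : ℝ)) (f := fun ε => 2 * (ρ.toReal + ε) * D) ?_
          (eventually_mem_nhdsWithin.mono hinf)
        have : Continuous fun ε : ℝ => 2 * (ρ.toReal + ε) * D := by fun_prop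
        simpa using (this.tendsto 0).mono_left nhdsWithin_le_nhds
      have h5 := mul_le_mul_of_nonneg_right (le_max_left 1 C₀)
        (mul_nonneg (ENNReal.toReal_nonneg (a := ρ)) hD)
      nlinarith
  have hlog : 0 ≤ Real.log (2 * s) := Real.log_nonneg (by linarith)
  calc Real.log (2 * s) * V ≤ Real.log (2 * s) * (2 * max 1 C₀ * ρ.toReal * D) :=
        mul_le_mul_of_nonneg_left h3 hlog
    _ = _ := by rw [rateEta]; ring

end SquareField

/-! ### The functions `η` and `α` -/

theorem rateEta_nonneg (β : ℝ → ℝ) {s : ℝ} (hs : 1 ≤ s) : 0 ≤ rateEta β s :=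
  mul_nonneg (Real.log_nonneg (by linarith)) ENNReal.toReal_nonneg

section Weight

variable {E : Type*} [MeasurableSpace E] {μ : Measure E} [IsProbabilityMeasure μ] {β : ℝ → ℝ}
  {ϱ : E → ℝ}

theorem one_le_of_inv_measure_le {A : Set E} {t : ℝ} (ht : (μ A)⁻¹ ≤ ENNReal.ofReal t) : 1 ≤ t := by
  have h1 : (1 : ℝ≥0∞) ≤ (μ A)⁻¹ := ENNReal.one_le_inv.2 prob_le_one
  have := h1.trans ht
  rwa [ENNReal.one_le_ofReal] at this

theorem weightAlpha_nonneg (s : ℝ) : 0 ≤ weightAlpha μ β ϱ s := by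
  apply Real.sSup_nonneg
  rintro _ ⟨t, ht, rfl⟩
  exact rateEta_nonneg β (one_le_of_inv_measure_le ht)

variable {K : ℝ}

theorem bddAbove_rateEta_image (hη : ∀ s : ℝ, 1 ≤ s → rateEta β s ≤ K) (A : Set E) :
    BddAbove (rateEta β '' {t : ℝ | (μ A)⁻¹ ≤ ENNReal.ofReal t}) := by
  refine ⟨K, ?_⟩
  rintro _ ⟨t, ht, rfl⟩
  exact hη t (one_le_of_inv_measure_le ht)

theorem weightAlpha_le (hη : ∀ s : ℝ, 1 ≤ s → rateEta β s ≤ K) (s : ℝ) :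
    weightAlpha μ β ϱ s ≤ K := by
  refine Real.sSup_le ?_ ((rateEta_nonneg β le_rfl).trans (hη 1 le_rfl))
  rintro _ ⟨t, ht, rfl⟩
  exact hη t (one_le_of_inv_measure_le ht)

theorem rateEta_le_weightAlpha (hη : ∀ s : ℝ, 1 ≤ s → rateEta β s ≤ K) {s t : ℝ}
    (ht : (μ {x | s - 2 ≤ ϱ x})⁻¹ ≤ ENNReal.ofReal t) : rateEta β t ≤ weightAlpha μ β ϱ s :=
  le_csSup (bddAbove_rateEta_image hη _) ⟨t, ht, rfl⟩

theorem antitone_weightAlpha (hη : ∀ s : ℝ, 1 ≤ s → rateEta β s ≤ K) :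
    Antitone (weightAlpha μ β ϱ) := by
  intro s t hst
  refine Real.sSup_le ?_ (weightAlpha_nonneg s)
  rintro _ ⟨r, hr, rfl⟩
  refine rateEta_le_weightAlpha hη (le_trans ?_ hr)
  rw [ENNReal.inv_le_inv]
  exact measure_mono fun x (hx : t - 2 ≤ ϱ x) => show s - 2 ≤ ϱ x by linarith

theorem isBoundedMeasurable_weightAlpha (hη : ∀ s : ℝ, 1 ≤ s → rateEta β s ≤ K)
    (hϱ : Measurable ϱ) : IsBoundedMeasurable fun x => weightAlpha μ β ϱ (ϱ x) :=
  ⟨(antitone_weightAlpha hη).measurable.comp hϱ, K, fun x => by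
    rw [abs_of_nonneg (weightAlpha_nonneg _)]
    exact weightAlpha_le hη _⟩

/-- If `β` is unbounded near `0`, then `η` is positive. -/
theorem rateEta_pos (hβ_anti : AntitoneOn β (Set.Ioi 0)) (hβ : ∀ B, ∃ r, 0 < r ∧ B < β r) {s : ℝ}
    (hs : 1 ≤ s) : 0 < rateEta β s := by
  refine mul_pos (Real.log_pos (by linarith)) (ENNReal.toReal_pos ?_ ?_)
  · obtain ⟨r, hr, hB⟩ := hβ (s / 2)
    have : ENNReal.ofReal r ≤ rateInv β (s / 2) := by
      refine le_iInf₂ fun t ht => ENNReal.ofReal_le_ofReal ?_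
      by_contra hlt
      have := hβ_anti (show t ∈ Set.Ioi 0 from ht.1) hr (not_le.1 hlt).le
      linarith [ht.2]
    refine (lt_min one_pos ((?_ : (0 : ℝ≥0∞) < _).trans_le this)).ne'
    simpa using hr
  · exact ((min_le_left _ _).trans_lt ENNReal.one_lt_top).ne

/-- The point `t = μ(ϱ ≥ s-2)⁻¹` is finite and admissible in the supremum. Together with
monotonicity this bounds the weight from below where `ϱ ≤ s`. -/
theorem weightAlpha_pos (hη : ∀ s : ℝ, 1 ≤ s → rateEta β s ≤ K)
    (hβ_anti : AntitoneOn β (Set.Ioi 0)) (hβ : ∀ B, ∃ r, 0 < r ∧ B < β r) {s : ℝ}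
    (hs : μ {x | s - 2 ≤ ϱ x} ≠ 0) : 0 < weightAlpha μ β ϱ s := by
  have ht : (μ {x | s - 2 ≤ ϱ x})⁻¹ ≤ ENNReal.ofReal (μ {x | s - 2 ≤ ϱ x})⁻¹.toReal := by
    rw [ENNReal.ofReal_toReal (ENNReal.inv_ne_top.2 hs)]
  exact (rateEta_pos hβ_anti hβ (one_le_of_inv_measure_le ht)).trans_le
    (rateEta_le_weightAlpha hη ht)

end Weight

/-! ### Localization to the shells of `ϱ` -/

namespace SquareField

variable {E : Type*} [MeasurableSpace E] {μ : Measure E} [IsProbabilityMeasure μ]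
  {ℰ : DirichletForm μ} {G : SquareField ℰ} {ϱ u : E → ℝ} {β : ℝ → ℝ} {C₀ K : ℝ}

/-- The weighted energy plus the `L²`-norm, localized by means of the function `ϱ`. -/
noncomputable def localEnergy (G : SquareField ℰ) (β : ℝ → ℝ) (ϱ : E → ℝ) (S : Set ℝ) (u : E → ℝ)
    (x : E) : ℝ :=
  S.indicator 1 (ϱ x) * (G.gamma u u x * weightAlpha μ β ϱ (ϱ x) + u x ^ 2)

theorem isBoundedMeasurable_gamma_mul_weight (hη : ∀ s : ℝ, 1 ≤ s → rateEta β s ≤ K)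
    (hϱm : Measurable ϱ) (hu : u ∈ G.carrier) :
    IsBoundedMeasurable fun x => G.gamma u u x * weightAlpha μ β ϱ (ϱ x) :=
  (G.isBoundedMeasurable_gamma hu hu).mul (isBoundedMeasurable_weightAlpha hη hϱm)

theorem isBoundedMeasurable_localEnergy (hη : ∀ s : ℝ, 1 ≤ s → rateEta β s ≤ K)
    (hϱm : Measurable ϱ) {S : Set ℝ} (hS : MeasurableSet S) (hu : u ∈ G.carrier) :
    IsBoundedMeasurable (G.localEnergy β ϱ S u) :=
  (IsBoundedMeasurable.indicator_one hS hϱm).mul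
    ((isBoundedMeasurable_gamma_mul_weight hη hϱm hu).add ((G.isBoundedMeasurable hu).pow 2))

theorem ae_gamma_mul_weight_nonneg (hu : u ∈ G.carrier) :
    ∀ᵐ x ∂μ, 0 ≤ G.gamma u u x * weightAlpha μ β ϱ (ϱ x) := by
  filter_upwards [G.gamma_nonneg u hu] with x hx
  exact mul_nonneg hx (weightAlpha_nonneg _)

theorem ae_localEnergy_nonneg (S : Set ℝ) (hu : u ∈ G.carrier) :
    ∀ᵐ x ∂μ, 0 ≤ G.localEnergy β ϱ S u x := by
  filter_upwards [ae_gamma_mul_weight_nonneg (β := β) (ϱ := ϱ) hu] with x hx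
  exact mul_nonneg (Set.indicator_nonneg (fun _ _ => zero_le_one) _) (by positivity)

/-- The small-support inequality for the product of `u` and a tent in `ϱ` around `k`. The shift by
`2` in `α` matches the width of the shell: `η(s) ≤ α(k+1)` refers to `μ(ϱ ≥ k-1)`, and `α(k+1) ≤
α(ϱ)` because `ϱ ≤ k+1`. The energy of the tent contributes at most `M²K u²`. -/
theorem exists_tent_inequality (hϱ : G.MemLoc ϱ) (hϱ_nonneg : ∀ x, 0 ≤ ϱ x)
    (hΓϱ : ∀ᵐ x ∂μ, G.gammaLoc ϱ ϱ x ≤ 1) (hη : ∀ s : ℝ, 1 ≤ s → rateEta β s ≤ K)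
    (hP : G.Poincare C₀) (hSP : G.SuperPoincare β) :
    ∃ D : ℝ, 0 < D ∧ ∀ u ∈ G.carrier, ∀ (T : ℝ) (k : ℕ), 2 ≤ T →
      μ {x | u x ≠ 0 ∧ (k : ℝ) - 1 ≤ ϱ x} ≤ ENNReal.ofReal (1 / T) →
      Real.log (2 * T) * ∫ x, (smoothTent (ϱ x - k) * u x) ^ 2 ∂μ ≤
        D * ∫ x, G.localEnergy β ϱ (Set.Icc (k - 1) (k + 1)) u x ∂μ := by
  obtain ⟨M, hM0, hM⟩ := exists_deriv_smoothTent_bound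
  have hK0 : 0 ≤ K := (rateEta_nonneg β le_rfl).trans (hη 1 le_rfl)
  have hC1 : 1 ≤ max 1 C₀ := le_max_left _ _
  refine ⟨2 * max 1 C₀ * (2 * (1 + M ^ 2 * K)), by positivity, fun u hu T k hT hsupp => ?_⟩
  have hϱm := hϱ.measurable hϱ_nonneg
  set v : E → ℝ := fun x => smoothTent (ϱ x - k) with hv_def
  obtain ⟨hv, hΓv⟩ := hϱ.comp_mem_and_gamma_le hϱ_nonneg hΓϱ (isSmoothBounded_smoothTent_sub k)
    (b := k + 1) (c := 0) fun t ht => smoothTent_eq_zero (by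
      rw [abs_of_nonneg (by linarith)]; linarith)
  set S : Set ℝ := Set.Icc (k - 1) (k + 1) with hS
  have hg := G.mul_mem v hv u hu
  have hR : 0 ≤ ∫ x, G.localEnergy β ϱ S u x ∂μ :=
    integral_nonneg_of_ae (ae_localEnergy_nonneg S hu)
  have hv0 : ∀ x, v x ≠ 0 → ϱ x ∈ S := fun x hx => by
    by_contra hc
    refine hx (smoothTent_eq_zero ?_)
    by_contra hlt
    have := abs_lt.1 (not_le.1 hlt)
    exact hc ⟨by linarith, by linarith⟩
  have hgS : {x | v x * u x ≠ 0} ⊆ {x | u x ≠ 0 ∧ (k : ℝ) - 1 ≤ ϱ x} := fun x hx =>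
    ⟨right_ne_zero_of_mul hx, (hv0 x (left_ne_zero_of_mul hx)).1⟩
  have hset : {x | (k : ℝ) + 1 - 2 ≤ ϱ x} = {x | (k : ℝ) - 1 ≤ ϱ x} := by
    rw [show (k : ℝ) + 1 - 2 = k - 1 by ring]
  -- In this degenerate case `α(k+1)` is a supremum over the empty set and bounds nothing, but the
  -- tent vanishes almost everywhere.
  by_cases hzero : μ {x | (k : ℝ) - 1 ≤ ϱ x} = 0
  · have : ∫ x, (v x * u x) ^ 2 ∂μ = 0 := by
      refine integral_eq_zero_of_ae ?_
      filter_upwards [compl_mem_ae_iff.2 hzero] with x hx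
      have : v x * u x = 0 := by
        by_contra hne
        exact hx (hgS hne).2
      simp [this]
    rw [this, mul_zero]
    positivity
  set m := (μ {x | (k : ℝ) - 1 ≤ ϱ x})⁻¹ with hm
  have hmtop : m ≠ ⊤ := ENNReal.inv_ne_top.2 hzero
  -- The larger of the two parameters: `s ≥ T` keeps the logarithm, `s ≥ μ(ϱ ≥ k-1)⁻¹` makes `η(s)`
  -- comparable with `α(k+1)`, and the support still has measure at most `1/s`.
  set s := max T m.toReal with hs
  have hsT : T ≤ s := le_max_left _ _
  have hms : m ≤ ENNReal.ofReal s := by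
    rw [← ENNReal.ofReal_toReal hmtop]
    exact ENNReal.ofReal_le_ofReal (le_max_right _ _)
  have hs0 : 0 < s := by linarith
  have hsupp' : μ {x | v x * u x ≠ 0} ≤ ENNReal.ofReal (1 / s) := by
    rcases le_total T m.toReal with h | h
    · have h1 : s = m.toReal := max_eq_right h
      rw [h1, one_div, ENNReal.ofReal_inv_of_pos (by linarith), ENNReal.ofReal_toReal hmtop, hm,
        inv_inv]
      exact measure_mono fun x hx => (hgS hx).2
    · have h1 : s = T := max_eq_left h
      rw [h1]
      exact (measure_mono hgS).trans hsupp
  have hmain := log_mul_integral_sq_le hP hSP hg (hT.trans hsT) hsupp'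
  have hηα : rateEta β s ≤ weightAlpha μ β ϱ (k + 1) :=
    rateEta_le_weightAlpha hη (by rw [hset]; exact hms)
  have hV : 0 ≤ ∫ x, (v x * u x) ^ 2 ∂μ := integral_nonneg fun x => sq_nonneg _
  have hE : weightAlpha μ β ϱ (k + 1) *
      ∫ x, G.gamma (fun x => v x * u x) (fun x => v x * u x) x ∂μ ≤
      2 * (1 + M ^ 2 * K) * ∫ x, G.localEnergy β ϱ S u x ∂μ := by
    rw [← integral_const_mul, ← integral_const_mul]
    refine integral_mono_ae (((G.isBoundedMeasurable_gamma hg hg).integrable μ).const_mul _)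
      (((isBoundedMeasurable_localEnergy hη hϱm measurableSet_Icc hu).integrable μ).const_mul _) ?_
    filter_upwards [G.ae_gamma_mul_self_le hv hu, hΓv, G.gamma_nonneg u hu, G.gamma_nonneg v hv]
      with x h1 h2 h3 h4
    have hα0 : 0 ≤ weightAlpha μ β ϱ (k + 1) := weightAlpha_nonneg _
    refine (mul_le_mul_of_nonneg_left h1 hα0).trans ?_
    by_cases hx : ϱ x ∈ S
    · have hα : weightAlpha μ β ϱ (k + 1) ≤ weightAlpha μ β ϱ (ϱ x) :=
        antitone_weightAlpha hη hx.2
      have hαK : weightAlpha μ β ϱ (k + 1) ≤ K := weightAlpha_le hη _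
      have hv1 : v x ^ 2 ≤ 1 := smoothTent_sq_le_one _
      have hd : G.gamma v v x ≤ M ^ 2 := by
        refine h2.trans ?_
        rw [deriv_comp_sub_const, ← sq_abs]
        exact pow_le_pow_left₀ (abs_nonneg _) (hM _) 2
      simp only [localEnergy, Set.indicator_of_mem hx, Pi.one_apply, one_mul]
      set a := weightAlpha μ β ϱ (k + 1)
      set b := weightAlpha μ β ϱ (ϱ x)
      have e1 : a * (v x ^ 2 * G.gamma u u x) ≤ b * G.gamma u u x :=
        mul_le_mul hα (mul_le_of_le_one_left h3 hv1) (by positivity) (hα0.trans hα)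
      have e2 : a * (u x ^ 2 * G.gamma v v x) ≤ K * (u x ^ 2 * M ^ 2) :=
        mul_le_mul hαK (mul_le_mul_of_nonneg_left hd (sq_nonneg _)) (by positivity) hK0
      have e3 : 0 ≤ M ^ 2 * K * (b * G.gamma u u x) := by
        have := hα0.trans hα
        positivity
      nlinarith [sq_nonneg (u x)]
    · have hvx : v x = 0 := by
        by_contra hne
        exact hx (hv0 x hne)
      have hd : G.gamma v v x = 0 := by
        refine le_antisymm (h2.trans ?_) h4
        rw [deriv_comp_sub_const, deriv_smoothTent_eq_zero]
        · simp
        · intro hc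
          exact hx ⟨by linarith [hc.1], by linarith [hc.2]⟩
      simp only [hv_def] at hvx hd
      simp [localEnergy, Set.indicator_of_notMem hx, hvx, hd]
  have hEnn := integral_gamma_nonneg hg
  calc Real.log (2 * T) * ∫ x, (v x * u x) ^ 2 ∂μ
      ≤ Real.log (2 * s) * ∫ x, (v x * u x) ^ 2 ∂μ :=
        mul_le_mul_of_nonneg_right (Real.log_le_log (by linarith) (by linarith)) hV
    _ ≤ 2 * max 1 C₀ * (rateEta β s *
          ∫ x, G.gamma (fun x => v x * u x) (fun x => v x * u x) x ∂μ) := by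
        rw [← mul_assoc]; exact hmain
    _ ≤ 2 * max 1 C₀ * (weightAlpha μ β ϱ (k + 1) *
          ∫ x, G.gamma (fun x => v x * u x) (fun x => v x * u x) x ∂μ) :=
        mul_le_mul_of_nonneg_left (mul_le_mul_of_nonneg_right hηα hEnn) (by positivity)
    _ ≤ 2 * max 1 C₀ * (2 * (1 + M ^ 2 * K) * ∫ x, G.localEnergy β ϱ S u x ∂μ) :=
        mul_le_mul_of_nonneg_left hE (by positivity)
    _ = _ := by ring

/-- Only `k` within distance `1` of `⌊t⌋₊` can contribute. -/
theorem sum_indicator_Icc_le (s : Finset ℕ) (t : ℝ) :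
    ∑ k ∈ s, (Set.Icc ((k : ℝ) - 1) (k + 1)).indicator (1 : ℝ → ℝ) t ≤ 3 := by
  have h : ∀ k ∈ s, (Set.Icc ((k : ℝ) - 1) (k + 1)).indicator (1 : ℝ → ℝ) t ≤
      if k ∈ Finset.Icc (⌊t⌋₊ - 1) (⌊t⌋₊ + 1) then 1 else 0 := fun k _ => by
    by_cases hk : t ∈ Set.Icc ((k : ℝ) - 1) (k + 1)
    · rw [Set.indicator_of_mem hk, if_pos]
      · rfl
      · rw [Finset.mem_Icc]
        constructor
        · have : ⌊t⌋₊ ≤ k + 1 := Nat.floor_le_of_le (by push_cast; exact hk.2)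
          omega
        · rcases Nat.eq_zero_or_pos k with h0 | h0
          · omega
          · have : k - 1 ≤ ⌊t⌋₊ := Nat.le_floor (by rw [Nat.cast_sub h0]; push_cast; exact hk.1)
            omega
    · rw [Set.indicator_of_notMem hk]
      split_ifs <;> simp
  refine (Finset.sum_le_sum h).trans ?_
  rw [Finset.sum_ite, Finset.sum_const_zero, add_zero, Finset.sum_const, nsmul_eq_mul, mul_one]
  have : (s.filter (· ∈ Finset.Icc (⌊t⌋₊ - 1) (⌊t⌋₊ + 1))).card ≤ 3 := by
    refine (Finset.card_le_card (t := Finset.Icc (⌊t⌋₊ - 1) (⌊t⌋₊ + 1)) fun k hk =>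
      (Finset.mem_filter.1 hk).2).trans ?_
    rw [Nat.card_Icc]; omega
  exact_mod_cast this

theorem indicator_le_sum_smoothTent (k₀ N : ℕ) (t : ℝ) :
    (Set.Icc (k₀ : ℝ) N).indicator (1 : ℝ → ℝ) t ≤
      ∑ k ∈ Finset.Icc k₀ N, smoothTent (t - k) ^ 2 := by
  have hnn : 0 ≤ ∑ k ∈ Finset.Icc k₀ N, smoothTent (t - k) ^ 2 :=
    Finset.sum_nonneg fun k _ => sq_nonneg _
  by_cases ht : t ∈ Set.Icc (k₀ : ℝ) N
  · rw [Set.indicator_of_mem ht, Pi.one_apply]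
    have ht0 : 0 ≤ t := (Nat.cast_nonneg _).trans ht.1
    -- The nearest integer, where the tent equals `1`.
    set j := ⌊t + 1 / 2⌋₊ with hj
    have hj1 : (j : ℝ) ≤ t + 1 / 2 := Nat.floor_le (by linarith)
    have hj2 : t + 1 / 2 < j + 1 := Nat.lt_floor_add_one _
    have hmem : j ∈ Finset.Icc k₀ N := by
      rw [Finset.mem_Icc]
      refine ⟨Nat.le_floor (by linarith [ht.1]), ?_⟩
      have : (j : ℝ) < N + 1 := by linarith [ht.2]
      have : j < N + 1 := by exact_mod_cast this
      omega
    refine le_trans ?_ (Finset.single_le_sum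
      (f := fun k : ℕ => smoothTent (t - k) ^ 2) (fun k _ => sq_nonneg _) hmem)
    rw [smoothTent_eq_one (abs_le.2 ⟨by linarith, by linarith⟩), one_pow]
  · rwa [Set.indicator_of_notMem ht]

/-- Integrated form of the spectral gap inequality on small sets. -/
theorem exists_tail_inequality (hϱ : G.MemLoc ϱ) (hϱ_nonneg : ∀ x, 0 ≤ ϱ x)
    (hΓϱ : ∀ᵐ x ∂μ, G.gammaLoc ϱ ϱ x ≤ 1) (hη : ∀ s : ℝ, 1 ≤ s → rateEta β s ≤ K)
    (hP : G.Poincare C₀) (hSP : G.SuperPoincare β) :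
    ∃ D : ℝ, 0 < D ∧ ∀ u ∈ G.carrier, ∀ (T : ℝ) (k₀ : ℕ), 2 ≤ T →
      μ {x | u x ≠ 0 ∧ (k₀ : ℝ) - 1 ≤ ϱ x} ≤ ENNReal.ofReal (1 / T) →
      Real.log (2 * T) * ∫ x, (Set.Ici (k₀ : ℝ)).indicator 1 (ϱ x) * u x ^ 2 ∂μ ≤
        D * (∫ x, G.gamma u u x * weightAlpha μ β ϱ (ϱ x) ∂μ + ∫ x, u x ^ 2 ∂μ) := by
  obtain ⟨D, hD, htent⟩ := exists_tent_inequality hϱ hϱ_nonneg hΓϱ hη hP hSP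
  have hϱm := hϱ.measurable hϱ_nonneg
  refine ⟨D * 3, by positivity, fun u hu T k₀ hT hsupp => ?_⟩
  have hlog : 0 ≤ Real.log (2 * T) := Real.log_nonneg (by linarith)
  have hub := G.isBoundedMeasurable hu
  have hW := isBoundedMeasurable_gamma_mul_weight (μ := μ) hη hϱm hu
  have hv : ∀ k : ℕ, IsBoundedMeasurable fun x => (smoothTent (ϱ x - k) * u x) ^ 2 := fun k =>
    IsBoundedMeasurable.pow (IsBoundedMeasurable.mul
      ⟨(contDiff_smoothTent.continuous.measurable.comp (hϱm.sub_const _)), 1,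
        fun _ => abs_smoothTransition_le _⟩ hub) 2
  have hle := fun k : ℕ => isBoundedMeasurable_localEnergy (μ := μ) hη hϱm
    (measurableSet_Icc (a := (k : ℝ) - 1) (b := k + 1)) hu
  have hfin : ∀ N : ℕ,
      Real.log (2 * T) * ∫ x, (Set.Icc (k₀ : ℝ) N).indicator 1 (ϱ x) * u x ^ 2 ∂μ ≤
        D * 3 * (∫ x, G.gamma u u x * weightAlpha μ β ϱ (ϱ x) ∂μ + ∫ x, u x ^ 2 ∂μ) := fun N => by
    calc Real.log (2 * T) * ∫ x, (Set.Icc (k₀ : ℝ) N).indicator 1 (ϱ x) * u x ^ 2 ∂μ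
        ≤ Real.log (2 * T) *
            ∫ x, ∑ k ∈ Finset.Icc k₀ N, (smoothTent (ϱ x - k) * u x) ^ 2 ∂μ := by
          refine mul_le_mul_of_nonneg_left (integral_mono
            (((IsBoundedMeasurable.indicator_one measurableSet_Icc hϱm).mul (hub.pow 2)).integrable μ)
            ((IsBoundedMeasurable.sum fun k _ => hv k).integrable μ) fun x => ?_) hlog
          simp only [mul_pow, ← Finset.sum_mul]
          exact mul_le_mul_of_nonneg_right (indicator_le_sum_smoothTent k₀ N (ϱ x)) (sq_nonneg _)
      _ = ∑ k ∈ Finset.Icc k₀ N,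
            Real.log (2 * T) * ∫ x, (smoothTent (ϱ x - k) * u x) ^ 2 ∂μ := by
          rw [integral_finsetSum _ fun k _ => (hv k).integrable μ, Finset.mul_sum]
      _ ≤ ∑ k ∈ Finset.Icc k₀ N,
            D * ∫ x, G.localEnergy β ϱ (Set.Icc (k - 1) (k + 1)) u x ∂μ := by
          refine Finset.sum_le_sum fun k hk => htent u hu T k hT ((measure_mono ?_).trans hsupp)
          rintro x ⟨h1, h2⟩
          have : (k₀ : ℝ) ≤ k := by exact_mod_cast (Finset.mem_Icc.1 hk).1
          exact ⟨h1, by linarith⟩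
      _ = D * ∫ x, ∑ k ∈ Finset.Icc k₀ N,
            G.localEnergy β ϱ (Set.Icc ((k : ℝ) - 1) (k + 1)) u x ∂μ := by
          rw [integral_finsetSum _ fun k _ => (hle k).integrable μ, Finset.mul_sum]
      _ ≤ D * ∫ x, 3 * (G.gamma u u x * weightAlpha μ β ϱ (ϱ x) + u x ^ 2) ∂μ := by
          refine mul_le_mul_of_nonneg_left (integral_mono_ae
            ((IsBoundedMeasurable.sum fun k _ => hle k).integrable μ)
            (((hW.add (hub.pow 2)).integrable μ).const_mul 3) ?_) hD.le
          filter_upwards [ae_gamma_mul_weight_nonneg (β := β) (ϱ := ϱ) hu] with x hx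
          simp only [localEnergy, ← Finset.sum_mul]
          exact mul_le_mul_of_nonneg_right (sum_indicator_Icc_le _ _) (by positivity)
      _ = _ := by
          rw [integral_const_mul, integral_add (hW.integrable μ) ((hub.pow 2).integrable μ)]
          ring
  -- The bound `hfin` is uniform in the number of shells, so `N → ∞` by dominated convergence.
  refine le_of_tendsto (Tendsto.const_mul _ (tendsto_integral_of_dominated_convergence
    (fun x => u x ^ 2) (fun N => ((IsBoundedMeasurable.indicator_one measurableSet_Icc hϱm).mul
      (hub.pow 2)).measurable.aestronglyMeasurable) ((hub.pow 2).integrable μ) (fun N =>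
      Eventually.of_forall fun x => ?_) (Eventually.of_forall fun x => ?_)))
    (Eventually.of_forall hfin)
  · rw [Real.norm_eq_abs, abs_of_nonneg (mul_nonneg
      (Set.indicator_nonneg (fun _ _ => zero_le_one) _) (sq_nonneg _))]
    refine mul_le_of_le_one_left (sq_nonneg _) ?_
    by_cases h : ϱ x ∈ Set.Icc (k₀ : ℝ) N <;> simp [h]
  · obtain ⟨N, hN⟩ := exists_nat_ge (ϱ x)
    refine tendsto_const_nhds.congr' ?_
    filter_upwards [eventually_ge_atTop N] with n hn
    have : ϱ x ≤ n := hN.trans (by exact_mod_cast hn)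
    simp [Set.indicator, this]

end SquareField

/-! ### Small tails and the weighted Poincaré inequality -/

theorem measure_antitone_eventually_le {E : Type*} [MeasurableSpace E] {μ : Measure E}
    [IsFiniteMeasure μ] {s : ℕ → Set E} (hm : ∀ n, MeasurableSet (s n)) (hs : Antitone s)
    (he : ⋂ n, s n = ∅) {T : ℝ} (hT : 0 < T) : ∃ n, μ (s n) ≤ ENNReal.ofReal (1 / T) := by
  have h := tendsto_measure_iInter_atTop (μ := μ) (fun n => (hm n).nullMeasurableSet) hs
    ⟨0, measure_ne_top _ _⟩
  rw [he, measure_empty] at h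
  have hpos : (0 : ℝ≥0∞) < ENNReal.ofReal (1 / T) := by simpa using hT
  obtain ⟨n, hn⟩ := (h.eventually (Iio_mem_nhds hpos)).exists
  exact ⟨n, le_of_lt hn⟩

theorem smoothStep_add_one (a t : ℝ) : smoothStep a (a + 1) t = smoothStep 0 1 (t - a) := by
  simp only [smoothStep]
  congr 1
  ring

theorem exists_deriv_smoothStep_bound : ∃ M : ℝ, 0 < M ∧
    ∀ a t, |deriv (smoothStep a (a + 1)) t| ≤ M := by
  obtain ⟨M, hM, -⟩ := (isSmoothBounded_smoothStep one_pos).exists_bound_deriv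
  refine ⟨M + 1, by positivity, fun a t => ?_⟩
  rw [funext (smoothStep_add_one a), deriv_comp_sub_const]
  exact (hM _).trans (by linarith)

theorem sq_integral_le_integral_sq {E : Type*} [MeasurableSpace E] {μ : Measure E}
    [IsProbabilityMeasure μ] {f : E → ℝ} (hf : IsBoundedMeasurable f) :
    (∫ x, f x ∂μ) ^ 2 ≤ ∫ x, f x ^ 2 ∂μ := by
  simpa using SquareField.sq_integral_le_of_support (μ := μ) hf one_pos (by simpa using prob_le_one)

namespace SquareField

variable {E : Type*} [MeasurableSpace E] {μ : Measure E} [IsProbabilityMeasure μ]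
  {ℰ : DirichletForm μ} {G : SquareField ℰ} {ϱ f u : E → ℝ} {β : ℝ → ℝ} {C₀ K : ℝ}

theorem integral_gamma_mul_weight_nonneg (hu : u ∈ G.carrier) :
    0 ≤ ∫ x, G.gamma u u x * weightAlpha μ β ϱ (ϱ x) ∂μ :=
  integral_nonneg_of_ae (ae_gamma_mul_weight_nonneg hu)

/-- The level `k₀` must be high enough for the tail to be small, yet positivity of `α(k₀+1)` needs
`μ(ϱ ≥ k₀-1) > 0`. If `ϱ` is essentially bounded, the first integer level of null measure satisfies
both; otherwise every level has positive measure and a high one is taken. -/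
theorem exists_small_tail (hϱ : G.MemLoc ϱ) (hϱ_nonneg : ∀ x, 0 ≤ ϱ x)
    (hΓϱ : ∀ᵐ x ∂μ, G.gammaLoc ϱ ϱ x ≤ 1) (hη : ∀ s : ℝ, 1 ≤ s → rateEta β s ≤ K)
    (hβ_anti : AntitoneOn β (Set.Ioi 0)) (hβ : ∀ B, ∃ r, 0 < r ∧ B < β r)
    (hP : G.Poincare C₀) (hSP : G.SuperPoincare β) {ε : ℝ} (hε : 0 < ε) :
    ∃ k₀ : ℕ, 0 < weightAlpha μ β ϱ (k₀ + 1) ∧ ∀ u ∈ G.carrier,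
      ∫ x, (Set.Ici (k₀ : ℝ)).indicator 1 (ϱ x) * u x ^ 2 ∂μ ≤
        ε * (∫ x, G.gamma u u x * weightAlpha μ β ϱ (ϱ x) ∂μ + ∫ x, u x ^ 2 ∂μ) := by
  classical
  have hϱm := hϱ.measurable hϱ_nonneg
  by_cases hex : ∃ j : ℕ, μ {x | (j : ℝ) ≤ ϱ x} = 0
  · have hj := Nat.find_spec hex
    have hmin := fun i => Nat.find_min hex (m := i)
    set j := Nat.find hex
    have hj0 : j ≠ 0 := by
      intro h0
      rw [h0] at hj
      simp [hϱ_nonneg] at hj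
    obtain ⟨i, hi⟩ := Nat.exists_eq_succ_of_ne_zero hj0
    refine ⟨j, weightAlpha_pos hη hβ_anti hβ ?_, fun u hu => ?_⟩
    · have : (j : ℝ) + 1 - 2 = i := by rw [hi]; push_cast; ring
      rw [this]
      exact hmin i (by omega)
    · have h0 : ∫ x, (Set.Ici (j : ℝ)).indicator 1 (ϱ x) * u x ^ 2 ∂μ = 0 := by
        refine integral_eq_zero_of_ae ?_
        filter_upwards [compl_mem_ae_iff.2 hj] with x hx
        have : ϱ x ∉ Set.Ici (j : ℝ) := hx
        simp [Set.indicator_of_notMem this]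
      rw [h0]
      exact mul_nonneg hε.le (add_nonneg (integral_gamma_mul_weight_nonneg hu)
        (integral_nonneg fun x => sq_nonneg _))
  · push Not at hex
    obtain ⟨D, hD, htail⟩ := exists_tail_inequality hϱ hϱ_nonneg hΓϱ hη hP hSP
    -- Chosen so that `log(2T) ≥ D/ε`.
    set T := max 2 (Real.exp (D / ε)) with hT
    have hT2 : 2 ≤ T := le_max_left _ _
    obtain ⟨n, hn⟩ := measure_antitone_eventually_le (μ := μ) (s := fun n : ℕ => {x | (n : ℝ) ≤ ϱ x})
      (fun n => measurableSet_le measurable_const hϱm)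
      (fun a b hab x (hx : (b : ℝ) ≤ ϱ x) =>
        show (a : ℝ) ≤ ϱ x from le_trans (by exact_mod_cast hab) hx)
      (by
        refine Set.eq_empty_of_forall_notMem fun x hx => ?_
        obtain ⟨m, hm⟩ := exists_nat_gt (ϱ x)
        exact absurd (Set.mem_iInter.1 hx m) (not_le.2 hm)) (T := T) (by linarith)
    refine ⟨n + 1, weightAlpha_pos hη hβ_anti hβ ?_, fun u hu => ?_⟩
    · refine (show ((n + 1 : ℕ) : ℝ) + 1 - 2 = n by push_cast; ring) ▸ hex n
    · have h := htail u hu T (n + 1) hT2 ((measure_mono ?_).trans hn)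
      · set Q := ∫ x, (Set.Ici ((n + 1 : ℕ) : ℝ)).indicator 1 (ϱ x) * u x ^ 2 ∂μ
        have hQ : 0 ≤ Q := integral_nonneg fun x =>
          mul_nonneg (Set.indicator_nonneg (fun _ _ => zero_le_one) _) (sq_nonneg _)
        have hlog : D / ε ≤ Real.log (2 * T) := by
          rw [Real.le_log_iff_exp_le (by linarith)]
          linarith [le_max_right 2 (Real.exp (D / ε))]
        have h1 := (mul_le_mul_of_nonneg_right hlog hQ).trans h
        have h2 : D / ε * Q = D * (Q / ε) := by ring
        rw [h2] at h1
        have h3 := le_of_mul_le_mul_left h1 hD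
        rwa [div_le_iff₀ hε, mul_comm _ ε] at h3
      · rintro x ⟨-, hx⟩
        push_cast at hx
        show (n : ℝ) ≤ ϱ x
        linarith

/-- The weighted Poincaré inequality. -/
theorem exists_weighted_poincare (hϱ : G.MemLoc ϱ) (hϱ_nonneg : ∀ x, 0 ≤ ϱ x)
    (hΓϱ : ∀ᵐ x ∂μ, G.gammaLoc ϱ ϱ x ≤ 1) (hη : ∀ s : ℝ, 1 ≤ s → rateEta β s ≤ K)
    (hβ_anti : AntitoneOn β (Set.Ioi 0)) (hβ : ∀ B, ∃ r, 0 < r ∧ B < β r)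
    (hC₀ : 0 < C₀) (hP : G.Poincare C₀) (hSP : G.SuperPoincare β) :
    ∃ C : ℝ, 0 < C ∧ ∀ f ∈ G.carrier, ∫ x, f x ∂μ = 0 →
      ∫ x, f x ^ 2 ∂μ ≤ C * ∫ x, G.gamma f f x * weightAlpha μ β ϱ (ϱ x) ∂μ := by
  have hϱm := hϱ.measurable hϱ_nonneg
  obtain ⟨M, hM0, hM⟩ := exists_deriv_smoothStep_bound
  -- The total coefficient of the tail `Q` in `hVD`: `2C₀M²` from the energy of the cut-off, `1`
  -- from the mean of `χf`, and `1` from the part of `f` lost. With `ε = 1/(2D)` half of `V` is then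
  -- absorbed.
  set D := 2 * C₀ * M ^ 2 + 2 with hDdef
  have hD : 0 < D := by positivity
  obtain ⟨k₀, hα, htail⟩ := exists_small_tail hϱ hϱ_nonneg hΓϱ hη hβ_anti hβ hP hSP
    (ε := 1 / (2 * D)) (by positivity)
  set a := weightAlpha μ β ϱ (k₀ + 1) with ha
  refine ⟨2 * (2 * C₀ / a) + 1, by positivity, fun f hf hf0 => ?_⟩
  have htail := htail f hf
  have hfb := G.isBoundedMeasurable hf
  have hWb := isBoundedMeasurable_gamma_mul_weight (μ := μ) hη hϱm hf
  have hind := IsBoundedMeasurable.indicator_one (measurableSet_Ici (a := (k₀ : ℝ))) hϱm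
  have hW := integral_gamma_mul_weight_nonneg (β := β) (ϱ := ϱ) hf
  set W := ∫ x, G.gamma f f x * weightAlpha μ β ϱ (ϱ x) ∂μ with hWdef
  set Q := ∫ x, (Set.Ici (k₀ : ℝ)).indicator 1 (ϱ x) * f x ^ 2 ∂μ with hQdef
  set V := ∫ x, f x ^ 2 ∂μ with hVdef
  have hk : (k₀ : ℝ) < k₀ + 1 := by linarith
  obtain ⟨hχ, hΓχ⟩ := hϱ.comp_mem_and_gamma_le hϱ_nonneg hΓϱ (isSmoothBounded_smoothStep hk)
    fun t ht => smoothStep_eq_zero hk ht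
  set χ : E → ℝ := fun x => smoothStep k₀ (k₀ + 1) (ϱ x) with hχdef
  have hχb := G.isBoundedMeasurable hχ
  have hχ0 : ∀ x, 0 ≤ χ x := fun x => Real.smoothTransition.nonneg _
  have hχ1 : ∀ x, χ x ≤ 1 := fun x => Real.smoothTransition.le_one _
  have hg := G.mul_mem χ hχ f hf
  have hPg := G.integral_sq_le_of_poincare hP hg
  have hcb : IsBoundedMeasurable fun x => (1 - χ x) * f x := ((IsBoundedMeasurable.const 1).sub hχb).mul hfb
  -- the part of `f` where the cut-off is not `1`
  have houter : ∀ x, ((1 - χ x) * f x) ^ 2 ≤ (Set.Ici (k₀ : ℝ)).indicator 1 (ϱ x) * f x ^ 2 :=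
    fun x => by
      rw [mul_pow]
      refine mul_le_mul_of_nonneg_right ?_ (sq_nonneg _)
      by_cases hx : ϱ x ∈ Set.Ici (k₀ : ℝ)
      · rw [Set.indicator_of_mem hx, Pi.one_apply]
        nlinarith [hχ0 x, hχ1 x]
      · rw [Set.indicator_of_notMem hx, hχdef]
        simp only
        rw [smoothStep_eq_one hk (le_of_not_ge hx)]
        simp
  -- As `f` has mean zero, the mean of `χf` is minus that of `(1-χ)f`, which lives on the tail.
  have hmean : (∫ x, χ x * f x ∂μ) ^ 2 ≤ Q := by
    have h1 : ∫ x, (1 - χ x) * f x ∂μ = - ∫ x, χ x * f x ∂μ := by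
      simp only [sub_mul, one_mul]
      rw [integral_sub (hfb.integrable μ) ((hχb.mul hfb).integrable μ), hf0, zero_sub]
    have h2 := sq_integral_le_integral_sq (μ := μ) hcb
    rw [h1, neg_sq] at h2
    exact h2.trans (integral_mono ((hcb.pow 2).integrable μ)
      ((hind.mul (hfb.pow 2)).integrable μ) houter)
  have hV : V ≤ ∫ x, (χ x * f x) ^ 2 ∂μ + Q := by
    rw [← integral_add (((hχb.mul hfb).pow 2).integrable μ) ((hind.mul (hfb.pow 2)).integrable μ)]
    refine integral_mono ((hfb.pow 2).integrable μ)
      ((((hχb.mul hfb).pow 2).add (hind.mul (hfb.pow 2))).integrable μ) fun x => ?_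
    simp only [mul_pow]
    by_cases hx : ϱ x ∈ Set.Ici (k₀ : ℝ)
    · rw [Set.indicator_of_mem hx, Pi.one_apply]
      nlinarith [mul_nonneg (sq_nonneg (χ x)) (sq_nonneg (f x))]
    · rw [Set.indicator_of_notMem hx, hχdef]
      simp only
      rw [smoothStep_eq_one hk (le_of_not_ge hx)]
      simp
  have hE : ∫ x, G.gamma (fun x => χ x * f x) (fun x => χ x * f x) x ∂μ ≤
      2 / a * W + 2 * M ^ 2 * Q := by
    rw [hWdef, hQdef, ← integral_const_mul, ← integral_const_mul, ← integral_add]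
    · refine integral_mono_ae ((G.isBoundedMeasurable_gamma hg hg).integrable μ)
        (((hWb.integrable μ).const_mul _).add
          (((hind.mul (hfb.pow 2)).integrable μ).const_mul _)) ?_
      filter_upwards [G.ae_gamma_mul_self_le hχ hf, hΓχ, G.gamma_nonneg f hf,
        ae_gamma_mul_weight_nonneg (β := β) (ϱ := ϱ) hf] with x h1 h2 h3 h4
      refine h1.trans ?_
      have e1 : f x ^ 2 * G.gamma χ χ x ≤
          M ^ 2 * ((Set.Ici (k₀ : ℝ)).indicator 1 (ϱ x) * f x ^ 2) := by
        have h5 : G.gamma χ χ x ≤ M ^ 2 * (Set.Ici (k₀ : ℝ)).indicator 1 (ϱ x) := by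
          refine h2.trans ?_
          by_cases hx : ϱ x ∈ Set.Ici (k₀ : ℝ)
          · rw [Set.indicator_of_mem hx, Pi.one_apply, mul_one, ← sq_abs]
            exact pow_le_pow_left₀ (abs_nonneg _) (hM _ _) 2
          · rw [deriv_smoothStep_eq_zero hk fun h => hx h.1, Set.indicator_of_notMem hx]
            simp
        nlinarith [mul_le_mul_of_nonneg_left h5 (sq_nonneg (f x))]
      have e2 : χ x ^ 2 * G.gamma f f x ≤
          1 / a * (G.gamma f f x * weightAlpha μ β ϱ (ϱ x)) := by
        rcases le_or_gt (ϱ x) (k₀ + 1) with hx | hx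
        · have h6 : a ≤ weightAlpha μ β ϱ (ϱ x) := antitone_weightAlpha hη hx
          have h7 : χ x ^ 2 ≤ 1 := pow_le_one₀ (hχ0 x) (hχ1 x)
          rw [div_mul_eq_mul_div, one_mul, le_div_iff₀ hα]
          have := mul_le_of_le_one_left h3 h7
          nlinarith
        · have : χ x = 0 := smoothStep_eq_zero hk hx.le
          rw [this]
          have : 0 ≤ 1 / a * (G.gamma f f x * weightAlpha μ β ϱ (ϱ x)) := by positivity
          simpa using this
      have e3 : 2 / a * (G.gamma f f x * weightAlpha μ β ϱ (ϱ x)) =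
        2 * (1 / a * (G.gamma f f x * weightAlpha μ β ϱ (ϱ x))) := by ring
      rw [e3]
      linarith
    · exact (hWb.integrable μ).const_mul _
    · exact ((hind.mul (hfb.pow 2)).integrable μ).const_mul _
  have hVD : V ≤ 2 * C₀ / a * W + D * Q := by
    have := mul_le_mul_of_nonneg_left hE hC₀.le
    have e : C₀ * (2 / a * W + 2 * M ^ 2 * Q) = 2 * C₀ / a * W + 2 * C₀ * M ^ 2 * Q := by ring
    rw [hDdef]
    linarith
  have hDQ : D * Q ≤ 1 / 2 * (W + V) := by
    have := mul_le_mul_of_nonneg_left htail hD.le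
    have e : D * (1 / (2 * D) * (W + V)) = 1 / 2 * (W + V) := by field_simp
    linarith
  linarith

/-! ### Dyadic decomposition of the entropy -/

/-- The derivatives of the level functions live on disjoint shells, so at each point at most one
level contributes energy. -/
theorem integral_gamma_dyadicLevel_mul_weight_le {M : ℝ} (hM : ∀ n t, |deriv (dyadicLevel n) t| ≤ M)
    (hη : ∀ s : ℝ, 1 ≤ s → rateEta β s ≤ K) (hϱm : Measurable ϱ) (hf : f ∈ G.carrier)
    (s : Finset ℕ) :
    ∑ n ∈ s, ∫ x, G.gamma (fun x => dyadicLevel n (f x)) (fun x => dyadicLevel n (f x)) x *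
        weightAlpha μ β ϱ (ϱ x) ∂μ ≤
      M ^ 2 * ∫ x, G.gamma f f x * weightAlpha μ β ϱ (ϱ x) ∂μ := by
  have hfn := fun n => G.comp_mem hf (isSmoothBounded_dyadicLevel n)
  have hb := fun n => isBoundedMeasurable_gamma_mul_weight (μ := μ) hη hϱm (hfn n)
  rw [← integral_finsetSum _ fun n _ => (hb n).integrable μ, ← integral_const_mul]
  refine integral_mono_ae ((IsBoundedMeasurable.sum fun n _ => hb n).integrable μ)
    (((isBoundedMeasurable_gamma_mul_weight hη hϱm hf).integrable μ).const_mul _) ?_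
  filter_upwards [ae_all_iff.2 fun n => G.gamma_comp_self hf (isSmoothBounded_dyadicLevel n),
    ae_gamma_mul_weight_nonneg (β := β) (ϱ := ϱ) hf] with x h1 h2
  simp only [h1, mul_assoc]
  rw [← Finset.sum_mul]
  refine mul_le_mul_of_nonneg_right ?_ h2
  by_cases h : ∃ j ∈ s, deriv (dyadicLevel j) (f x) ≠ 0
  · obtain ⟨j, hj, hne⟩ := h
    have hloc : ∀ n, deriv (dyadicLevel n) (f x) ≠ 0 → 2 ^ n ≤ |f x| ∧ |f x| < 2 ^ (n + 1) :=
      fun n hn => by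
        by_contra hc
        exact hn (deriv_dyadicLevel_eq_zero hc)
    rw [Finset.sum_eq_single_of_mem j hj, ← sq_abs]
    · exact pow_le_pow_left₀ (abs_nonneg _) (hM _ _) 2
    · intro n _ hnj
      by_contra hc
      have hn := hloc n fun h0 => hc (by rw [h0]; ring)
      have hj := hloc j hne
      have l1 := (pow_lt_pow_iff_right₀ (one_lt_two (α := ℝ))).1 (hn.1.trans_lt hj.2)
      have l2 := (pow_lt_pow_iff_right₀ (one_lt_two (α := ℝ))).1 (hj.1.trans_lt hn.2)
      omega
  · push Not at h
    rw [Finset.sum_eq_zero fun n hn => by rw [h n hn]; ring]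
    positivity

theorem natCast_le_log (n : ℕ) : (n : ℝ) ≤ Real.log (2 * 4 ^ n) := by
  rw [Real.le_log_iff_exp_le (by positivity), ← mul_one (n : ℝ), Real.exp_nat_mul]
  have h : Real.exp 1 ≤ 4 := by linarith [Real.exp_one_lt_d9]
  have := pow_le_pow_left₀ (Real.exp_pos 1).le h n
  have : (0 : ℝ) < 4 ^ n := by positivity
  linarith

/-- The high level sets of a normalized function are controlled by the weighted energy. -/
theorem exists_level_inequality (hϱ : G.MemLoc ϱ) (hϱ_nonneg : ∀ x, 0 ≤ ϱ x)
    (hΓϱ : ∀ᵐ x ∂μ, G.gammaLoc ϱ ϱ x ≤ 1) (hη : ∀ s : ℝ, 1 ≤ s → rateEta β s ≤ K)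
    (hP : G.Poincare C₀) (hSP : G.SuperPoincare β) :
    ∃ (n₀ : ℕ) (C : ℝ), 1 ≤ n₀ ∧ 0 < C ∧ ∀ f ∈ G.carrier, ∫ x, f x ^ 2 ∂μ = 1 → ∀ N : ℕ,
      ∑ n ∈ Finset.Ico n₀ N, (n : ℝ) * ∫ x, dyadicLevel n (f x) ^ 2 ∂μ ≤
        C * ∫ x, G.gamma f f x * weightAlpha μ β ϱ (ϱ x) ∂μ := by
  have hϱm := hϱ.measurable hϱ_nonneg
  obtain ⟨D, hD, htail⟩ := exists_tail_inequality hϱ hϱ_nonneg hΓϱ hη hP hSP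
  obtain ⟨M, hM0, hM⟩ := exists_deriv_dyadicLevel_bound
  -- From `n ≥ 2D` the term `D V` on the right is at most half of `n V`; the extra `1` gives `n₀ ≥
  -- 1`, hence `4^n ≥ 2`.
  obtain ⟨n₀, hn₀⟩ := exists_nat_ge (2 * D + 1)
  have hn₀1 : 1 ≤ n₀ := by
    have : (1 : ℝ) ≤ n₀ := by linarith
    exact_mod_cast this
  refine ⟨n₀, 2 * D * M ^ 2, hn₀1, by positivity, fun f hf hf1 N => ?_⟩
  have hfb := G.isBoundedMeasurable hf
  have hstep : ∀ n ∈ Finset.Ico n₀ N, (n : ℝ) * ∫ x, dyadicLevel n (f x) ^ 2 ∂μ ≤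
      2 * D * ∫ x, G.gamma (fun x => dyadicLevel n (f x)) (fun x => dyadicLevel n (f x)) x *
        weightAlpha μ β ϱ (ϱ x) ∂μ := fun n hn => by
    have hn' : n₀ ≤ n := (Finset.mem_Ico.1 hn).1
    have hnD : 2 * D ≤ n := by
      have : (n₀ : ℝ) ≤ n := by exact_mod_cast hn'
      linarith
    have hfn := G.comp_mem hf (isSmoothBounded_dyadicLevel n)
    have hT : (2 : ℝ) ≤ 4 ^ n := by
      have : (4 : ℝ) ^ 1 ≤ 4 ^ n := pow_le_pow_right₀ (by norm_num) (hn₀1.trans hn')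
      linarith
    -- With `k₀ = 0` the tail is the whole space; the remaining bound on the support is Markov's
    -- inequality for `f²`.
    have h := htail _ hfn (4 ^ n) 0 hT ?_
    · have hind : ∀ x, (Set.Ici ((0 : ℕ) : ℝ)).indicator (1 : ℝ → ℝ) (ϱ x) = 1 := fun x => by
        simp [Set.indicator, hϱ_nonneg x]
      simp only [hind, one_mul] at h
      set V := ∫ x, dyadicLevel n (f x) ^ 2 ∂μ
      have hV : 0 ≤ V := integral_nonneg fun x => sq_nonneg _
      have := mul_le_mul_of_nonneg_right (natCast_le_log n) hV
      nlinarith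
    · refine (measure_mono (t := {x | (4 : ℝ) ^ n ≤ f x ^ 2}) ?_).trans ?_
      · rintro x ⟨hx, -⟩
        have hlt : 2 ^ n < |f x| := by
          by_contra hc
          exact hx (dyadicLevel_eq_zero (not_lt.1 hc))
        have := pow_le_pow_left₀ (by positivity) hlt.le 2
        rw [sq_abs, ← pow_mul, mul_comm, pow_mul] at this
        norm_num at this
        exact this
      · have h1 := mul_meas_ge_le_integral_of_nonneg (μ := μ)
          (Eventually.of_forall fun x => sq_nonneg (f x)) ((hfb.pow 2).integrable μ) (4 ^ n)
        rw [hf1, mul_comm, ← le_div_iff₀ (by positivity)] at h1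
        rw [← ENNReal.ofReal_toReal (measure_ne_top μ _)]
        exact ENNReal.ofReal_le_ofReal h1
  refine (Finset.sum_le_sum hstep).trans ?_
  rw [← Finset.mul_sum, mul_assoc (2 * D)]
  exact mul_le_mul_of_nonneg_left (integral_gamma_dyadicLevel_mul_weight_le hM hη hϱm hf _)
    (by positivity)

end SquareField

/-- For moderate `x`, `t log t - t + 1 ≤ (t-1)²` at `t = x²`, and `(x²-1)² = (x+ε)²(x-ε)²` with
`x+ε` bounded. For large `x` a single dyadic level dominates, and `96 = 16 · 6` combines `x² ≤ 16 ·
4^n` with `log x² ≤ 6n`. -/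
theorem sq_mul_log_sq_le {n₀ N : ℕ} (hn₀ : 1 ≤ n₀) {x ε : ℝ} (hε : ε ^ 2 = 1) (hx : |x| < 2 ^ N) :
    x ^ 2 * Real.log (x ^ 2) - x ^ 2 + 1 ≤ (2 ^ (n₀ + 1) + 1) ^ 2 * (x - ε) ^ 2 +
      96 * ∑ n ∈ Finset.Ico n₀ N, (n : ℝ) * dyadicLevel n x ^ 2 := by
  have hsum : ∀ n ∈ Finset.Ico n₀ N, 0 ≤ (n : ℝ) * dyadicLevel n x ^ 2 := fun n _ => by positivity
  rcases le_or_gt |x| (2 ^ (n₀ + 1)) with h | h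
  · have h1 : x ^ 2 * Real.log (x ^ 2) - x ^ 2 + 1 ≤ (x ^ 2 - 1) ^ 2 := by
      rcases eq_or_ne x 0 with rfl | hx0
      · simp
      · have := Real.log_le_sub_one_of_pos (show 0 < x ^ 2 by positivity)
        nlinarith [mul_le_mul_of_nonneg_left this (sq_nonneg x)]
    have hεa : |ε| = 1 := by
      rw [← sq_eq_sq₀ (abs_nonneg _) zero_le_one, sq_abs, hε, one_pow]
    have h2 : (x + ε) ^ 2 ≤ (2 ^ (n₀ + 1) + 1) ^ 2 := by
      rw [← sq_abs]
      refine pow_le_pow_left₀ (abs_nonneg _) ((abs_add_le _ _).trans ?_) 2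
      linarith
    have h3 : (x ^ 2 - 1) ^ 2 = (x + ε) ^ 2 * (x - ε) ^ 2 := by
      rw [← hε]; ring
    have := mul_le_mul_of_nonneg_right h2 (sq_nonneg (x - ε))
    have := Finset.sum_nonneg hsum
    linarith
  · have hone : (1 : ℝ) ≤ 2 ^ (n₀ + 1) := one_le_pow₀ one_le_two
    obtain ⟨j, hj1, hj2⟩ := exists_nat_pow_near (hone.trans h.le) (one_lt_two (α := ℝ))
    have l1 := (pow_lt_pow_iff_right₀ (one_lt_two (α := ℝ))).1 (h.trans hj2)
    have l2 := (pow_lt_pow_iff_right₀ (one_lt_two (α := ℝ))).1 (hj1.trans_lt hx)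
    -- One level below that of `|x|`, so that the level function has reached its plateau `2^n`.
    obtain ⟨n, rfl⟩ : ∃ n, j = n + 1 := ⟨j - 1, by omega⟩
    have hmem : n ∈ Finset.Ico n₀ N := Finset.mem_Ico.2 ⟨by omega, by omega⟩
    have hs := Finset.single_le_sum hsum hmem
    rw [dyadicLevel_eq hj1] at hs
    have hn1 : (1 : ℝ) ≤ n := by exact_mod_cast (show 1 ≤ n by omega)
    have hx1 : 1 ≤ |x| := hone.trans h.le
    have hxsq : x ^ 2 ≤ 16 * (2 ^ n) ^ 2 := by
      have := pow_le_pow_left₀ (abs_nonneg x) hj2.le 2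
      rw [sq_abs] at this
      refine this.trans_eq ?_
      ring
    have hlog : Real.log (x ^ 2) ≤ 6 * n := by
      have e1 : Real.log |x| ≤ (n + 2 : ℕ) * Real.log 2 := by
        rw [← Real.log_pow]
        exact Real.log_le_log (by linarith) hj2.le
      have e2 : Real.log 2 ≤ 1 := by linarith [Real.log_two_lt_d9]
      rw [← sq_abs, Real.log_pow]
      push_cast at e1 ⊢
      nlinarith
    have hx1' : 1 ≤ x ^ 2 := by rw [← sq_abs]; exact one_le_pow₀ hx1
    have hprod : x ^ 2 * Real.log (x ^ 2) ≤ 16 * (2 ^ n) ^ 2 * (6 * n) :=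
      mul_le_mul hxsq hlog (Real.log_nonneg hx1') (by positivity)
    have : 0 ≤ (2 ^ (n₀ + 1) + 1) ^ 2 * (x - ε) ^ 2 := by positivity
    linarith

/-! ### Bounded rate functions: triviality of the algebra -/

namespace SquareField

variable {E : Type*} [MeasurableSpace E] {μ : Measure E} [IsProbabilityMeasure μ]
  {ℰ : DirichletForm μ} {G : SquareField ℰ} {ϱ f u : E → ℝ} {β : ℝ → ℝ} {C₀ K : ℝ}

/-- If the rate function is bounded, functions with small support vanish. -/
theorem ae_eq_zero_of_small_support (hSP : G.SuperPoincare β) {B : ℝ}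
    (hB : ∀ r, 0 < r → β r ≤ B) (hu : u ∈ G.carrier) {s : ℝ} (hs : 0 < s) (hBs : B < s)
    (hsupp : μ {x | u x ≠ 0} ≤ ENNReal.ofReal (1 / s)) : u =ᵐ[μ] 0 := by
  have hub := G.isBoundedMeasurable hu
  have hcs := sq_integral_le_of_support hub.abs hs (by simpa using hsupp)
  simp only [sq_abs] at hcs
  set V := ∫ x, u x ^ 2 ∂μ with hVdef
  set I := ∫ x, |u x| ∂μ
  -- Letting `r → 0` removes the energy; then `s I² ≤ V ≤ B I²` with `B < s` forces `I = 0`.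
  have hlim : V ≤ 0 * ∫ x, G.gamma u u x ∂μ + B * I ^ 2 := by
    refine ge_of_tendsto (x := 𝓝[>] (0 : ℝ))
      (f := fun r => r * ∫ x, G.gamma u u x ∂μ + B * I ^ 2) ?_ ?_
    · have : Continuous fun r : ℝ => r * ∫ x, G.gamma u u x ∂μ + B * I ^ 2 := by fun_prop
      exact (this.tendsto 0).mono_left nhdsWithin_le_nhds
    · filter_upwards [eventually_mem_nhdsWithin] with r hr
      have := G.integral_sq_le_of_superPoincare hSP hr hu
      linarith [mul_le_mul_of_nonneg_right (hB r hr) (sq_nonneg I)]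
  have hI : I ^ 2 = 0 := by nlinarith [sq_nonneg I]
  have hV0 : V = 0 := le_antisymm (by rw [hI] at hlim; linarith) (integral_nonneg fun x => sq_nonneg _)
  rw [hVdef, integral_eq_zero_iff_of_nonneg (fun x => sq_nonneg _) ((hub.pow 2).integrable μ)] at hV0
  filter_upwards [hV0] with x hx
  exact pow_eq_zero_iff two_ne_zero |>.1 hx

/-- If the rate function is bounded, the algebra consists of constants. -/
theorem ae_eq_integral_of_rate_bounded (hP : G.Poincare C₀) (hSP : G.SuperPoincare β) {B : ℝ}
    (hB : ∀ r, 0 < r → β r ≤ B) (hf : f ∈ G.carrier) : f =ᵐ[μ] fun _ => ∫ y, f y ∂μ := by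
  have hfb := G.isBoundedMeasurable hf
  set m := ∫ y, f y ∂μ with hm
  have hfm := hfb.sub (IsBoundedMeasurable.const m)
  have hfm0 : ∫ x, (f x - m) ∂μ = 0 := by
    rw [integral_sub (hfb.integrable μ) (integrable_const m)]
    simp [hm]
  -- a gap in the range of `f` above its mean
  obtain ⟨δ, hδ, hgap⟩ : ∃ δ : ℝ, 0 < δ ∧ ∀ᵐ x ∂μ, f x ∉ Set.Ioo m (m + δ) := by
    obtain ⟨n, hn⟩ := measure_antitone_eventually_le (μ := μ)
      (s := fun n : ℕ => f ⁻¹' Set.Ioo m (m + 1 / ((n : ℝ) + 1)))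
      (fun n => hfb.measurable measurableSet_Ioo)
      (fun a b hab => Set.preimage_mono (Set.Ioo_subset_Ioo_right
        (by linarith [Nat.one_div_le_one_div (α := ℝ) hab])))
      (by
        refine Set.eq_empty_of_forall_notMem fun x hx => ?_
        have hx := Set.mem_iInter.1 hx
        obtain ⟨k, hk⟩ := exists_nat_one_div_lt (sub_pos.2 (hx 0).1)
        have := (hx k).2
        linarith) (T := max 1 (B + 1)) (by positivity)
    set δ : ℝ := 1 / ((n : ℝ) + 1) with hδdef
    have hδ : 0 < δ := by positivity
    -- A tent over the interval: composed with `f`, it has small support, so it vanishes almost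
    -- everywhere although it is positive inside the interval.
    have hlip : LipschitzWith 1 fun t : ℝ => max 0 (δ / 2 - |t - (m + δ / 2)|) := by
      refine LipschitzWith.const_max (LipschitzWith.of_dist_le_mul fun s t => ?_) 0
      rw [Real.dist_eq, Real.dist_eq, NNReal.coe_one, one_mul]
      have h1 : δ / 2 - |s - (m + δ / 2)| - (δ / 2 - |t - (m + δ / 2)|) =
        |t - (m + δ / 2)| - |s - (m + δ / 2)| := by ring
      rw [h1, abs_sub_comm s t]
      refine (abs_abs_sub_abs_le _ _).trans_eq ?_
      congr 1
      ring
    have hu := G.lipschitz_comp_mem f hf _ 1 hlip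
    have hsub : {x | max 0 (δ / 2 - |f x - (m + δ / 2)|) ≠ 0} ⊆ f ⁻¹' Set.Ioo m (m + δ) := by
      intro x (hx : max 0 (δ / 2 - |f x - (m + δ / 2)|) ≠ 0)
      have h0 : |f x - (m + δ / 2)| < δ / 2 := by
        by_contra hc
        exact hx (max_eq_left (by linarith))
      obtain ⟨h1, h2⟩ := abs_lt.1 h0
      exact ⟨by linarith, by linarith⟩
    refine ⟨δ, hδ, ?_⟩
    filter_upwards [ae_eq_zero_of_small_support hSP hB hu (s := max 1 (B + 1)) (by positivity)
      ((lt_add_one B).trans_le (le_max_right _ _)) ((measure_mono hsub).trans hn)] with x hx hmem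
    have hpos : 0 < δ / 2 - |f x - (m + δ / 2)| := by
      rw [sub_pos, abs_lt]
      constructor <;> linarith [hmem.1, hmem.2]
    have h0 : max 0 (δ / 2 - |f x - (m + δ / 2)|) = 0 := hx
    exact (h0 ▸ le_max_right 0 (δ / 2 - |f x - (m + δ / 2)|)).not_gt hpos
  have hab : m + δ / 3 < m + 2 * δ / 3 := by linarith
  have hφ := isSmoothBounded_smoothStep hab
  have hv := G.comp_mem hf hφ
  have hvb := G.isBoundedMeasurable hv
  have hle : ∀ x, f x ≤ m → smoothStep (m + δ / 3) (m + 2 * δ / 3) (f x) = 1 := fun x hx =>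
    smoothStep_eq_one hab (by linarith)
  have hgt : ∀ᵐ x ∂μ, m < f x → smoothStep (m + δ / 3) (m + 2 * δ / 3) (f x) = 0 := by
    filter_upwards [hgap] with x hx hmx
    refine smoothStep_eq_zero hab ?_
    by_contra hc
    exact hx ⟨hmx, by linarith [not_le.1 hc]⟩
  set v : E → ℝ := fun x => smoothStep (m + δ / 3) (m + 2 * δ / 3) (f x) with hvdef
  -- The step decreases only inside the gap, so `v` has zero energy and takes the values `0` and `1`
  -- almost everywhere. The Poincaré inequality then reads `p ≤ p²` for `p = μ(v)`, whence `p` is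
  -- `0` or `1`.
  have hΓ : ∫ x, G.gamma v v x ∂μ = 0 := by
    refine integral_eq_zero_of_ae ?_
    filter_upwards [G.gamma_comp_self hf hφ, hgap] with x h1 h2
    rw [h1, deriv_smoothStep_eq_zero hab fun hc => h2 ⟨by linarith [hc.1], by linarith [hc.2]⟩]
    simp
  have hsq : ∫ x, v x ^ 2 ∂μ = ∫ x, v x ∂μ := by
    refine integral_congr_ae ?_
    filter_upwards [hgt] with x hx
    rcases le_or_gt (f x) m with h | h
    · rw [show v x = 1 from hle x h, one_pow]
    · rw [show v x = 0 from hx h]; norm_num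
  have hp := G.integral_sq_le_of_poincare hP hv
  rw [hΓ, hsq, mul_zero, zero_add] at hp
  have hv0 : ∀ x, 0 ≤ v x := fun x => Real.smoothTransition.nonneg _
  have hv1 : ∀ x, v x ≤ 1 := fun x => Real.smoothTransition.le_one _
  have hp0 : 0 ≤ ∫ x, v x ∂μ := integral_nonneg hv0
  -- In either case `f - m` has a constant sign almost everywhere and integral zero.
  rcases hp0.eq_or_lt with h | h
  · have hvz := (integral_eq_zero_iff_of_nonneg hv0 (hvb.integrable μ)).1 h.symm
    have hnn : 0 ≤ᵐ[μ] fun x => f x - m := by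
      filter_upwards [hvz] with x hx
      by_contra hc
      have : f x ≤ m := by
        have := not_le.1 hc
        simp only [Pi.zero_apply] at this
        linarith
      have h1 := hle x this
      simp only [Pi.zero_apply] at hx
      linarith
    filter_upwards [(integral_eq_zero_iff_of_nonneg_ae hnn (hfm.integrable μ)).1 hfm0] with x hx
    exact sub_eq_zero.1 hx
  · have h1 : 1 ≤ ∫ x, v x ∂μ := by
      by_contra hc
      nlinarith [not_le.1 hc]
    have h2 : ∫ x, (1 - v x) ∂μ = 0 := by
      refine le_antisymm ?_ (integral_nonneg fun x => sub_nonneg.2 (hv1 x))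
      rw [integral_sub (integrable_const 1) (hvb.integrable μ)]
      simpa using h1
    have hvz := (integral_eq_zero_iff_of_nonneg (fun x => sub_nonneg.2 (hv1 x))
      (((IsBoundedMeasurable.const 1).sub hvb).integrable μ)).1 h2
    have hnn : 0 ≤ᵐ[μ] fun x => -(f x - m) := by
      filter_upwards [hvz, hgt] with x hx hx'
      by_contra hc
      have hlt : m < f x := by
        have := not_le.1 hc
        simp only [Pi.zero_apply] at this
        linarith
      have := hx' hlt
      simp only [Pi.zero_apply] at hx
      linarith
    have hneg : ∫ x, -(f x - m) ∂μ = 0 := by rw [integral_neg, hfm0, neg_zero]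
    filter_upwards [(integral_eq_zero_iff_of_nonneg_ae hnn (hfm.neg.integrable μ)).1 hneg] with x hx
    simp only [Pi.zero_apply] at hx
    linarith

theorem weightedLogSobolev_of_rate_bounded (hP : G.Poincare C₀) (hSP : G.SuperPoincare β) {B : ℝ}
    (hB : ∀ r, 0 < r → β r ≤ B) :
    G.WeightedLogSobolev (fun x => weightAlpha μ β ϱ (ϱ x)) 1 := by
  intro f hf hf1
  have hconst := ae_eq_integral_of_rate_bounded hP hSP hB hf
  set m := ∫ y, f y ∂μ
  have hm : m ^ 2 = 1 := by
    have h : ∫ x, f x ^ 2 ∂μ = ∫ _, m ^ 2 ∂μ := by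
      refine integral_congr_ae ?_
      filter_upwards [hconst] with x hx
      rw [hx]
    rw [hf1] at h
    simpa using h.symm
  have h0 : ∫ x, f x ^ 2 * Real.log (f x ^ 2) ∂μ = 0 := by
    refine integral_eq_zero_of_ae ?_
    filter_upwards [hconst] with x hx
    rw [hx, hm]
    simp
  rw [h0, one_mul]
  exact integral_gamma_mul_weight_nonneg hf

/-! ### Unbounded rate functions and conclusion -/

theorem exists_weightedLogSobolev_of_rate_unbounded (hϱ : G.MemLoc ϱ) (hϱ_nonneg : ∀ x, 0 ≤ ϱ x)
    (hΓϱ : ∀ᵐ x ∂μ, G.gammaLoc ϱ ϱ x ≤ 1) (hη : ∀ s : ℝ, 1 ≤ s → rateEta β s ≤ K)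
    (hβ_anti : AntitoneOn β (Set.Ioi 0)) (hβ : ∀ B, ∃ r, 0 < r ∧ B < β r)
    (hC₀ : 0 < C₀) (hP : G.Poincare C₀) (hSP : G.SuperPoincare β) :
    ∃ C : ℝ, 0 < C ∧ G.WeightedLogSobolev (fun x => weightAlpha μ β ϱ (ϱ x)) C := by
  obtain ⟨Cp, hCp, hpoin⟩ := exists_weighted_poincare hϱ hϱ_nonneg hΓϱ hη hβ_anti hβ hC₀ hP hSP
  obtain ⟨n₀, Cl, hn₀, hCl, hlevel⟩ := exists_level_inequality hϱ hϱ_nonneg hΓϱ hη hP hSP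
  refine ⟨(2 ^ (n₀ + 1) + 1) ^ 2 * (2 * Cp) + 96 * Cl, by positivity, fun f hf hf1 => ?_⟩
  have hfb := G.isBoundedMeasurable hf
  obtain ⟨L, hL⟩ := hfb.bounded
  obtain ⟨N, hN⟩ := pow_unbounded_of_one_lt L (one_lt_two (α := ℝ))
  have hlevel := hlevel f hf hf1 N
  set m := ∫ x, f x ∂μ with hm
  -- the variance
  have hpoin := hpoin _ (G.sub_const_mem hf m) (by
    rw [integral_sub (hfb.integrable μ) (integrable_const m)]
    simp [hm])
  have hWeq : ∫ x, G.gamma (fun x => f x - m) (fun x => f x - m) x * weightAlpha μ β ϱ (ϱ x) ∂μ =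
      ∫ x, G.gamma f f x * weightAlpha μ β ϱ (ϱ x) ∂μ := by
    refine integral_congr_ae ?_
    filter_upwards [G.gamma_sub_const_self hf m] with x hx
    rw [hx]
  rw [hWeq] at hpoin
  set W := ∫ x, G.gamma f f x * weightAlpha μ β ϱ (ϱ x) ∂μ
  have hquad : ∀ c : ℝ, ∫ x, (f x - c) ^ 2 ∂μ = 1 - 2 * c * m + c ^ 2 := fun c => by
    have e : ∀ x, (f x - c) ^ 2 = f x ^ 2 - 2 * c * f x + c ^ 2 := fun x => by ring
    simp only [e]
    rw [integral_add (((hfb.pow 2).sub ((IsBoundedMeasurable.const (2 * c)).mul hfb)).integrable μ)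
      (integrable_const _), integral_sub ((hfb.pow 2).integrable μ) ((hfb.integrable μ).const_mul _),
      integral_const_mul, hf1]
    simp [hm]
  rw [hquad m] at hpoin
  have hm1 : m ^ 2 ≤ 1 := (sq_integral_le_integral_sq hfb).trans_eq hf1
  -- With `ε` a sign of the mean, `μ((f-ε)²) = 2 - 2|m| ≤ 2(1 - m²)`, twice the variance.
  obtain ⟨ε, hε, hεm⟩ : ∃ ε : ℝ, ε ^ 2 = 1 ∧ ε * m = |m| := by
    rcases le_total 0 m with h | h
    · exact ⟨1, by norm_num, by rw [abs_of_nonneg h, one_mul]⟩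
    · exact ⟨-1, by norm_num, by rw [abs_of_nonpos h]; ring⟩
  have hε2 : ∫ x, (f x - ε) ^ 2 ∂μ ≤ 2 * Cp * W := by
    rw [hquad ε]
    have h1 : |m| ≤ 1 := (sq_le_one_iff_abs_le_one m).1 hm1
    have h2 : m ^ 2 ≤ |m| := by rw [← sq_abs]; nlinarith [abs_nonneg m]
    nlinarith
  have hlb : IsBoundedMeasurable fun x => f x ^ 2 * Real.log (f x ^ 2) :=
    (hfb.pow 2).comp_continuous Real.continuous_mul_log
  have hdb : ∀ n : ℕ, IsBoundedMeasurable fun x => (n : ℝ) * dyadicLevel n (f x) ^ 2 := fun n =>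
    (IsBoundedMeasurable.const (n : ℝ)).mul
      ((G.isBoundedMeasurable (G.comp_mem hf (isSmoothBounded_dyadicLevel n))).pow 2)
  have hεb := (hfb.sub (IsBoundedMeasurable.const ε)).pow 2
  have hsb : IsBoundedMeasurable fun x =>
      ∑ n ∈ Finset.Ico n₀ N, (n : ℝ) * dyadicLevel n (f x) ^ 2 :=
    IsBoundedMeasurable.sum fun n _ => hdb n
  -- The correction `-f² + 1` in the pointwise bound integrates to zero, which leaves the entropy on
  -- the left.
  have hmono := integral_mono
    (((hlb.sub (hfb.pow 2)).add (IsBoundedMeasurable.const 1)).integrable μ)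
    ((((IsBoundedMeasurable.const ((2 ^ (n₀ + 1) + 1) ^ 2)).mul hεb).add
      ((IsBoundedMeasurable.const 96).mul hsb)).integrable μ)
    fun x => sq_mul_log_sq_le hn₀ hε ((hL x).trans_lt hN)
  rw [integral_add ((hlb.sub (hfb.pow 2)).integrable μ) (integrable_const 1),
    integral_sub (hlb.integrable μ) ((hfb.pow 2).integrable μ), hf1,
    integral_add ((hεb.integrable μ).const_mul _) ((hsb.integrable μ).const_mul _),
    integral_const_mul, integral_const_mul, integral_finsetSum _ fun n _ => (hdb n).integrable μ]
    at hmono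
  simp only [integral_const_mul, integral_const, probReal_univ, smul_eq_mul, mul_one] at hmono
  have := mul_le_mul_of_nonneg_left hε2 (show (0 : ℝ) ≤ (2 ^ (n₀ + 1) + 1) ^ 2 by positivity)
  show ∫ x, f x ^ 2 * Real.log (f x ^ 2) ∂μ ≤ ((2 ^ (n₀ + 1) + 1) ^ 2 * (2 * Cp) + 96 * Cl) * W
  nlinarith

end SquareField

theorem theorem2p1 {E : Type*} [MeasurableSpace E] (μ : Measure E) [IsProbabilityMeasure μ]
    [μ.IsComplete] [IsSeparable μ]
    (ℰ : DirichletForm μ) (hcons : ℰ.IsConservative) (G : SquareField ℰ)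
    (ϱ : E → ℝ) (hϱ : G.MemLoc ϱ) (hϱ_nonneg : ∀ x, 0 ≤ ϱ x)
    (hΓϱ : ∀ᵐ x ∂μ, G.gammaLoc ϱ ϱ x ≤ 1)
    (β : ℝ → ℝ) (hβ_pos : ∀ r : ℝ, 0 < r → 0 < β r) (hβ_anti : AntitoneOn β (Set.Ioi 0))
    (hβ_cont : ContinuousOn β (Set.Ioi 0))
    (hη : ∃ K : ℝ, ∀ s : ℝ, 1 ≤ s → rateEta β s ≤ K)
    (C₀ : ℝ) (hC₀ : 0 < C₀) (hP : G.Poincare C₀)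
    (hSP : G.SuperPoincare β) :
    ∃ C : ℝ, 0 < C ∧ G.WeightedLogSobolev (fun x => weightAlpha μ β ϱ (ϱ x)) C := by
  obtain ⟨K, hK⟩ := hη
  by_cases hβ : ∃ B, ∀ r, 0 < r → β r ≤ B
  · obtain ⟨B, hB⟩ := hβ
    exact ⟨1, one_pos, SquareField.weightedLogSobolev_of_rate_bounded hP hSP hB⟩
  · push Not at hβ
    exact SquareField.exists_weightedLogSobolev_of_rate_unbounded hϱ hϱ_nonneg hΓϱ hK hβ_anti hβ
      hC₀ hP hSP
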